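/- Let $\Omega\subset\mathbb R^2$ be a bounded connected open set whose boundary is the disjoint union of $q$ piecewise smooth simple closed curves $\partial_1\Omega,\dots,\partial_q\Omega$ (with $\Omega$ lying locally on one side), of lengths $|\partial_\alpha\Omega|$, and let $|\partial\Omega|=\sum_\alpha|\partial_\alpha\Omega|$. Parametrize each $\partial_\alpha\Omega$ by arclength $s\in[0,|\partial_\alpha\Omega|)$ with respect to the positive orientation, from a chosen reference point. Let $\Phi$ be the phase space of the billiard map: its points are triples $z=(\alpha,s,\theta)$, with footpoint $p(z)\in\partial_\alpha\Omega$ of coordinate $s$ and $0<\theta<\pi$ the angle between the positive tangent and the direction of motion. Let $\varphi:\Phi\to\Phi$ be the billiard map (defined almost everywhere) and $d\nu=\sin\theta\,ds\,d\theta$ the Liouville measure, so $\nu(\Phi)=2|\partial\Omega|$. For $z\in\Phi$, $1\le\alpha\le q$ and $N\in\mathbb N$ let $0\le k_0<\dots<k_n\le N$ be the times $k\le N$ with $p(\varphi^{k}(z))\in\partial_\alpha\Omega$, let $s_i\in[0,|\partial_\alpha\Omega|)$ be the coordinate of $p(\varphi^{k_i}(z))$, and let $\xi_i\in[0,|\partial_\alpha\Omega|)$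 be the number with $s_i+\xi_i=s_{i+1}$ or $s_i+\xi_i=s_{i+1}+|\partial_\alpha\Omega|$. Put $$\upsilon_\alpha(z)=\lim_{N\to\infty}\frac{\xi_0+\dots+\xi_{n-1}}{N},\qquad \vec\rho(z)=\Bigl(\frac{\upsilon_1(z)}{|\partial_1\Omega|},\dots,\frac{\upsilon_q(z)}{|\partial_q\Omega|}\Bigr).$$ Let $R_\alpha\subset\Phi$ be the set of phase points $z$ with $p(z)\in\partial_\alpha\Omega$ for which the next visit of the orbit to $\partial_\alpha\Omega$ occurs at the same point $p(z)$. Then these limits exist for $\nu$-almost all $z$, the functions $\upsilon_\alpha$ are $\nu$-integrable, and for every $\alpha$ $$\int_\Phi\upsilon_\alpha\,d\nu=|\partial_\alpha\Omega|^2-\tfrac12|\partial_\alpha\Omega|\,\nu(R_\alpha).$$ Consequently, if almost surely consecutive visits to a boundary component occur at different points, i.e. $\nu(R_\alpha)=0$ for all $\alpha$, then $\int_\Phi\upsilon_\alpha\,d\nu=|\partial_\alpha\Omega|^2$ for every $\alpha$, and the mean rotation vector is $$\frac{\int_\Phi\vec\rho\,d\nu}{\nu(\Phi)}=\frac12\Bigl(\frac{|\partial_1\Omega|}{|\partial\Omega|},\dots,\frac{|\partial_q\Omega|}{|\partial\Omega|}\Bigr);$$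 if, moreover, the billiard is ergodic, then $\vec\rho(z)$ equals this vector for $\nu$-almost all $z\in\Phi$. -/

import Mathlib

open Filter Topology MeasureTheory

noncomputable section

/-- A bounded `q`-connected planar domain with piecewise smooth boundary, together with a choice of
reference points on the boundary components.  The plane is `ℂ`.  The boundary is the disjoint union
of `q` simple closed curves; the curve `α` is the image of `γ α`, an `L α`-periodic parametrization
by arclength with respect to the positive orientation (the domain is on the left, and only there).
Smoothness of the pieces is asked only in the weakest sense (`C¹` away from finitely many corners of
each curve), so that tables with `C^k` or `C^∞` pieces are all included. -/
structure BilliardTable (q : ℕ) where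
  /-- the domain -/
  Ω : Set ℂ
  isOpen : IsOpen Ω
  isConnected : IsConnected Ω
  isBounded : Bornology.IsBounded Ω
  /-- the lengths of the boundary components -/
  L : Fin q → ℝ
  L_pos : ∀ α, 0 < L α
  /-- the arclength parametrizations of the boundary components -/
  γ : Fin q → ℝ → ℂ
  continuous : ∀ α, Continuous (γ α)
  periodic : ∀ α, Function.Periodic (γ α) (L α)
  injOn : ∀ α, Set.InjOn (γ α) (Set.Ico 0 (L α))
  disjoint : Pairwise fun α β => Disjoint (Set.range (γ α)) (Set.range (γ β))
  frontier_eq : frontier Ω = ⋃ α, Set.range (γ α)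
  finite_corners : ∀ α, {s ∈ Set.Ico 0 (L α) | ¬ ContDiffAt ℝ 1 (γ α) s}.Finite
  unit_speed : ∀ α s, ContDiffAt ℝ 1 (γ α) s → ‖deriv (γ α) s‖ = 1
  left_mem : ∀ α s, ContDiffAt ℝ 1 (γ α) s →
    ∀ᶠ t : ℝ in 𝓝[>] 0, γ α s + t * (Complex.I * deriv (γ α) s) ∈ Ω
  right_notMem : ∀ α s, ContDiffAt ℝ 1 (γ α) s →
    ∀ᶠ t : ℝ in 𝓝[>] 0, γ α s - t * (Complex.I * deriv (γ α) s) ∉ Ω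

namespace BilliardTable

variable {q : ℕ} (T : BilliardTable q)

/-- The perimeter `|∂Ω|`. -/
def perimeter : ℝ := ∑ α, T.L α

/-- The phase space: triples `(α, s, θ)`, where `α` is the boundary component of the footpoint, `s`
its arclength coordinate, and `θ` the angle between the positive tangent and the velocity. -/
def phaseSpace : Set (Fin q × ℝ × ℝ) :=
  {z | z.2.1 ∈ Set.Ico 0 (T.L z.1) ∧ z.2.2 ∈ Set.Ioo 0 Real.pi}

/-- The Liouville measure `dν = sin θ ds dθ` on the phase space. -/
def liouville : Measure (Fin q × ℝ × ℝ) :=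
  ((Measure.count.prod (volume.prod volume)).restrict T.phaseSpace).withDensity
    fun z => ENNReal.ofReal (Real.sin z.2.2)

/-- The footpoint of a phase point. -/
def footpoint (z : Fin q × ℝ × ℝ) : ℂ := T.γ z.1 z.2.1

/-- The boundary is smooth at the footpoint. -/
def IsRegular (z : Fin q × ℝ × ℝ) : Prop := ContDiffAt ℝ 1 (T.γ z.1) z.2.1

/-- The unit vector at the footpoint that makes the angle `θ` with the positive tangent. -/
def direction (z : Fin q × ℝ × ℝ) (θ : ℝ) : ℂ :=
  Complex.exp (θ * Complex.I) * deriv (T.γ z.1) z.2.1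

/-- `w` is the phase point that follows `z`: the ray from the footpoint of `z` in the direction of
`z` runs inside `Ω` up to the footpoint of `w`, arrives there with the angle `-θ` to the positive
tangent, and leaves with the angle `θ` (angle of incidence equals angle of reflection). -/
def IsNext (z w : Fin q × ℝ × ℝ) : Prop :=
  z ∈ T.phaseSpace ∧ w ∈ T.phaseSpace ∧ T.IsRegular z ∧ T.IsRegular w ∧
  (∃ t : ℝ, 0 < t ∧ T.footpoint w = T.footpoint z + t * T.direction z z.2.2 ∧
    ∀ r ∈ Set.Ioo 0 t, T.footpoint z + r * T.direction z z.2.2 ∈ T.Ω) ∧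
  T.direction z z.2.2 = T.direction w (-w.2.2)

open Classical in
/-- The billiard map.  It is the identity at the (Liouville-null) set of points of the phase space
that have no successor: those at a corner and those whose ray runs into a corner or is tangent to
the boundary where it first meets it. -/
def billiardMap (z : Fin q × ℝ × ℝ) : Fin q × ℝ × ℝ :=
  if h : ∃ w, T.IsNext z w then h.choose else z

/-- The number `0 ≤ ξ < L` with `s + ξ = s'` or `s + ξ = s' + L`, for `0 ≤ s, s' < L`. -/
def increment (L s s' : ℝ) : ℝ := if s ≤ s' then s' - s else s' + L - s

/-- At time `k`, the orbit of `z` has its footpoint on the boundary component `α`. -/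
def Visits (α : Fin q) (z : Fin q × ℝ × ℝ) (k : ℕ) : Prop := (T.billiardMap^[k] z).1 = α

/-- The times `k < l` are consecutive visits of the orbit of `z` to the boundary component `α`. -/
def ConsecutiveVisits (α : Fin q) (z : Fin q × ℝ × ℝ) (k l : ℕ) : Prop :=
  k < l ∧ T.Visits α z k ∧ T.Visits α z l ∧ ∀ j, k < j → j < l → ¬ T.Visits α z j

open Classical in
/-- The sum `ξ₀ + ⋯ + ξₙ₋₁` of the increments over all pairs of consecutive visits to `α` up to
time `N`. -/
def totalIncrement (α : Fin q) (z : Fin q × ℝ × ℝ) (N : ℕ) : ℝ :=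
  ∑ k ∈ Finset.range (N + 1), ∑ l ∈ Finset.range (N + 1),
    if T.ConsecutiveVisits α z k l then
      increment (T.L α) (T.billiardMap^[k] z).2.1 (T.billiardMap^[l] z).2.1
    else 0

/-- The limit that defines the `α`-component of the footpoint gain vector exists and is `u`. -/
def HasFootpointGain (α : Fin q) (z : Fin q × ℝ × ℝ) (u : ℝ) : Prop :=
  Tendsto (fun N : ℕ => T.totalIncrement α z N / N) atTop (𝓝 u)

/-- The footpoint gain vector (meaningful where the limits exist). -/
def footpointGain (z : Fin q × ℝ × ℝ) : Fin q → ℝ :=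
  fun α => limUnder atTop fun N : ℕ => T.totalIncrement α z N / N

/-- The rotation vector. -/
def rotationVector (z : Fin q × ℝ × ℝ) : Fin q → ℝ :=
  fun α => T.footpointGain z α / T.L α

/-- The phase points on the boundary component `α` whose next visit to `α` has the same footpoint. -/
def closedReturns (α : Fin q) : Set (Fin q × ℝ × ℝ) :=
  {z | ∃ n, T.ConsecutiveVisits α z 0 n ∧ (T.billiardMap^[n] z).2.1 = z.2.1}

/-- The billiard is ergodic: every measurable invariant set is null or has null complement. -/
def IsErgodic : Prop := PreErgodic T.billiardMap T.liouville

end BilliardTable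

end

/-!
A phase point determines the line carrying its ray, hence an angle `φ` and an offset `p` from the
origin. In these coordinates `sin θ ds dθ` is the area `dφ dp`, and the end of a ray, looked at
backwards, lies on the same line; as the reversal of the velocity also preserves the area, the
billiard map preserves the Liouville measure.

Let the gain of a phase point on `α` be the increment of the arclength coordinate up to the next
visit to `α`. Its Birkhoff sums differ from the total increments by a bounded amount, because at
most one visit before time `N` is still waiting for its successor at time `N`. Hence `υ_α` is the
Birkhoff limit of the gain, and has the same integral.

Time reversal exchanges the two ends of a return to `α`. If these are different points, the two
increments add up to the length `L` of `α`; if they coincide, both increments vanish. So the gain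
has mean `L / 2` over the returns to a different point and vanishes on the closed ones, while the
phase points on `α` have measure `2 L`.
-/

noncomputable section

section BirkhoffTheorem

variable {X : Type*} {T : X → X} {g : X → ℝ} {C : ℝ}

theorem partialSups_birkhoffSum_le (T : X → X) (g : X → ℝ) (n : ℕ) (x : X) :
    partialSups (birkhoffSum T g) n x ≤ max 0 (g x + partialSups (birkhoffSum T g) n (T x)) := by
  rw [Pi.partialSups_apply]
  refine partialSups_le _ _ _ fun k hk => ?_
  cases k with
  | zero => exact le_max_left _ _
  | succ k =>
    rw [birkhoffSum_succ']
    have h : birkhoffSum T g k ≤ partialSups (birkhoffSum T g) n :=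
      le_partialSups_of_le _ ((Nat.le_succ k).trans hk)
    exact (add_le_add_right (h (T x)) _).trans (le_max_right _ _)

theorem partialSups_birkhoffSum_nonneg (T : X → X) (g : X → ℝ) (n : ℕ) (x : X) :
    0 ≤ partialSups (birkhoffSum T g) n x :=
  le_partialSups_of_le (birkhoffSum T g) n.zero_le x

theorem partialSups_birkhoffSum_sub_le_indicator (T : X → X) (g : X → ℝ) (n : ℕ) (x : X) :
    partialSups (birkhoffSum T g) n x - partialSups (birkhoffSum T g) n (T x) ≤
      {y | 0 < partialSups (birkhoffSum T g) n y}.indicator g x := by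
  by_cases h : 0 < partialSups (birkhoffSum T g) n x
  · rw [Set.indicator_of_mem (by exact h)]
    rcases le_max_iff.1 (partialSups_birkhoffSum_le T g n x) with h' | h' <;> linarith
  · rw [Set.indicator_of_notMem (by exact h)]
    linarith [partialSups_birkhoffSum_nonneg T g n (T x)]

theorem abs_birkhoffAverage_le (hC : ∀ x, |g x| ≤ C) (n : ℕ) (x : X) :
    |birkhoffAverage ℝ T g n x| ≤ C := by
  rcases n.eq_zero_or_pos with rfl | hn
  · simpa using (abs_nonneg _).trans (hC x)
  · have hn' : (0 : ℝ) < n := by exact_mod_cast hn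
    rw [birkhoffAverage, smul_eq_mul, abs_mul, abs_of_pos (inv_pos.2 hn'), inv_mul_le_iff₀ hn',
      birkhoffSum]
    refine (Finset.abs_sum_le_sum_abs _ _).trans ((Finset.sum_le_sum fun k _ => hC _).trans ?_)
    simp

theorem isBoundedUnder_le_birkhoffAverage (hC : ∀ x, |g x| ≤ C) (x : X) :
    IsBoundedUnder (· ≤ ·) atTop (fun n => birkhoffAverage ℝ T g n x) :=
  isBoundedUnder_of ⟨C, fun n => (abs_le.1 (abs_birkhoffAverage_le hC n x)).2⟩

theorem isBoundedUnder_ge_birkhoffAverage (hC : ∀ x, |g x| ≤ C) (x : X) :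
    IsBoundedUnder (· ≥ ·) atTop (fun n => birkhoffAverage ℝ T g n x) :=
  isBoundedUnder_of ⟨-C, fun n => (abs_le.1 (abs_birkhoffAverage_le hC n x)).1⟩

/-- The upper limit of the Birkhoff averages of `g`; for bounded `g` and a finite invariant measure
it represents the almost sure limit of the averages by an everywhere invariant function. -/
def birkhoffLimsup (T : X → X) (g : X → ℝ) (x : X) : ℝ :=
  limsup (fun n => birkhoffAverage ℝ T g n x) atTop

theorem abs_birkhoffLimsup_le (hC : ∀ x, |g x| ≤ C) (x : X) : |birkhoffLimsup T g x| ≤ C := by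
  have hlow (n : ℕ) := (abs_le.1 (abs_birkhoffAverage_le (T := T) hC n x)).1
  have hup (n : ℕ) := (abs_le.1 (abs_birkhoffAverage_le (T := T) hC n x)).2
  exact abs_le.2 ⟨le_limsup_of_le (isBoundedUnder_le_birkhoffAverage hC x)
      fun b hb => (hb.exists.elim fun n hn => (hlow n).trans hn),
    limsup_le_of_le (isBoundedUnder_ge_birkhoffAverage hC x).isCoboundedUnder_le
      (Eventually.of_forall hup)⟩

theorem limsup_le_limsup_of_tendsto_sub {u v : ℕ → ℝ} (hu : IsBoundedUnder (· ≥ ·) atTop u)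
    (hv : IsBoundedUnder (· ≤ ·) atTop v) (hv' : IsBoundedUnder (· ≥ ·) atTop v)
    (h : Tendsto (fun n => v n - u n) atTop (𝓝 0)) : limsup u atTop ≤ limsup v atTop := by
  rw [le_limsup_iff hv'.isCoboundedUnder_le hv]
  intro c hc
  obtain ⟨d, hcd, hd⟩ := exists_between hc
  have hud := frequently_lt_of_lt_limsup hu.isCoboundedUnder_le hd
  have hvu := h.eventually (lt_mem_nhds (show c - d < 0 by linarith))
  exact (hud.and_eventually hvu).mono fun n hn => by linarith [hn.1, hn.2]

theorem birkhoffLimsup_apply_map (hC : ∀ x, |g x| ≤ C) (x : X) :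
    birkhoffLimsup T g (T x) = birkhoffLimsup T g x := by
  have hle := isBoundedUnder_le_birkhoffAverage (T := T) hC
  have hge := isBoundedUnder_ge_birkhoffAverage (T := T) hC
  have hbdd : Bornology.IsBounded (Set.range g) :=
    isBounded_iff_forall_norm_le.2 ⟨C, by rintro _ ⟨y, rfl⟩; exact hC y⟩
  have h := tendsto_birkhoffAverage_apply_sub_birkhoffAverage' ℝ hbdd T x
  refine le_antisymm (limsup_le_limsup_of_tendsto_sub (hge _) (hle _) (hge _) ?_)
    (limsup_le_limsup_of_tendsto_sub (hge _) (hle _) (hge _) h)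
  simpa using h.neg

theorem birkhoffLimsup_iterate (hC : ∀ x, |g x| ≤ C) (k : ℕ) (x : X) :
    birkhoffLimsup T g (T^[k] x) = birkhoffLimsup T g x := by
  induction k with
  | zero => rfl
  | succ k ih => rw [Function.iterate_succ_apply', birkhoffLimsup_apply_map hC, ih]

theorem exists_birkhoffSum_sub_birkhoffLimsup_pos (hC : ∀ x, |g x| ≤ C) {ε : ℝ} (hε : 0 < ε)
    (x : X) : ∃ n, 0 < birkhoffSum T (fun y => g y - (birkhoffLimsup T g y - ε)) n x := by
  have hfreq := frequently_lt_of_lt_limsup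
    (isBoundedUnder_ge_birkhoffAverage (T := T) hC x).isCoboundedUnder_le
    (show birkhoffLimsup T g x - ε < birkhoffLimsup T g x by linarith)
  obtain ⟨n, hn, hn0⟩ := (hfreq.and_eventually (eventually_gt_atTop 0)).exists
  refine ⟨n, ?_⟩
  have hn' : (0 : ℝ) < n := by exact_mod_cast hn0
  rw [birkhoffAverage, smul_eq_mul, lt_inv_mul_iff₀ hn'] at hn
  simpa [birkhoffSum, Finset.sum_sub_distrib, birkhoffLimsup_iterate hC, mul_sub] using hn

theorem neg_birkhoffLimsup_neg (hC : ∀ x, |g x| ≤ C) (x : X) :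
    -birkhoffLimsup T (-g) x = liminf (fun n => birkhoffAverage ℝ T g n x) atTop := by
  have hC' : ∀ x, |(-g) x| ≤ C := fun x => (abs_neg (g x)).trans_le (hC x)
  have hneg : Antitone (fun y : ℝ => -y) := fun _ _ => neg_le_neg
  refine (hneg.map_limsup_of_continuousAt _ continuous_neg.continuousAt
    (isBoundedUnder_le_birkhoffAverage hC' x)
    (isBoundedUnder_ge_birkhoffAverage hC' x).isCoboundedUnder_le).trans ?_
  simp only [birkhoffAverage_neg, Function.comp_def, Pi.neg_apply, neg_neg]

theorem neg_birkhoffLimsup_neg_le (hC : ∀ x, |g x| ≤ C) (x : X) :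
    -birkhoffLimsup T (-g) x ≤ birkhoffLimsup T g x := by
  rw [neg_birkhoffLimsup_neg hC]
  exact liminf_le_limsup (isBoundedUnder_le_birkhoffAverage hC x)
    (isBoundedUnder_ge_birkhoffAverage hC x)

variable [MeasurableSpace X] {μ : Measure X}

theorem measurable_birkhoffSum (hT : Measurable T) (hg : Measurable g) (n : ℕ) :
    Measurable (birkhoffSum T g n) :=
  Finset.measurable_sum _ fun k _ => hg.comp (hT.iterate k)

theorem integrable_birkhoffSum (hT : MeasurePreserving T μ μ) (hg : Integrable g μ) (n : ℕ) :
    Integrable (birkhoffSum T g n) μ :=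
  integrable_finsetSum _ fun k _ => (hT.iterate k).integrable_comp_of_integrable hg

theorem measurable_partialSups_birkhoffSum (hT : Measurable T) (hg : Measurable g) (n : ℕ) :
    Measurable (partialSups (birkhoffSum T g) n) := by
  induction n with
  | zero => exact measurable_birkhoffSum hT hg 0
  | succ n ih =>
    rw [partialSups_add_one]
    exact ih.sup (measurable_birkhoffSum hT hg _)

theorem integrable_partialSups_birkhoffSum (hT : MeasurePreserving T μ μ) (hg : Integrable g μ)
    (n : ℕ) : Integrable (partialSups (birkhoffSum T g) n) μ := by
  induction n with
  | zero => exact integrable_birkhoffSum hT hg 0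
  | succ n ih =>
    rw [partialSups_add_one]
    exact ih.sup (integrable_birkhoffSum hT hg _)

theorem measurableSet_partialSups_birkhoffSum_pos (hT : Measurable T) (hg : Measurable g) (n : ℕ) :
    MeasurableSet {x | 0 < partialSups (birkhoffSum T g) n x} :=
  measurableSet_lt measurable_const (measurable_partialSups_birkhoffSum hT hg n)

theorem integral_indicator_partialSups_birkhoffSum_pos_nonneg (hT : MeasurePreserving T μ μ)
    (hgm : Measurable g) (hg : Integrable g μ) (n : ℕ) :
    0 ≤ ∫ x, {y | 0 < partialSups (birkhoffSum T g) n y}.indicator g x ∂μ := by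
  have hM := integrable_partialSups_birkhoffSum hT hg n
  have hM' := hT.integrable_comp_of_integrable hM
  calc (0 : ℝ) = ∫ x, partialSups (birkhoffSum T g) n x -
        partialSups (birkhoffSum T g) n (T x) ∂μ := by
        have h := integral_map hT.aemeasurable (f := partialSups (birkhoffSum T g) n)
          (by rw [hT.map_eq]; exact hM.aestronglyMeasurable)
        rw [hT.map_eq] at h
        exact ((integral_sub hM hM').trans (sub_eq_zero.2 h)).symm
    _ ≤ _ := integral_mono (hM.sub hM')
        (hg.indicator (measurableSet_partialSups_birkhoffSum_pos hT.measurable hgm n))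
        (partialSups_birkhoffSum_sub_le_indicator T g n)

theorem integral_nonneg_of_exists_birkhoffSum_pos (hT : MeasurePreserving T μ μ)
    (hgm : Measurable g) (hg : Integrable g μ) (h : ∀ᵐ x ∂μ, ∃ n, 0 < birkhoffSum T g n x) :
    0 ≤ ∫ x, g x ∂μ := by
  refine ge_of_tendsto' (tendsto_integral_of_dominated_convergence (fun x => ‖g x‖)
    (fun n => (hg.indicator
      (measurableSet_partialSups_birkhoffSum_pos hT.measurable hgm n)).aestronglyMeasurable)
    hg.norm (fun n => Eventually.of_forall fun x => norm_indicator_le_norm_self _ _) ?_)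
    (integral_indicator_partialSups_birkhoffSum_pos_nonneg hT hgm hg)
  filter_upwards [h] with x ⟨n, hn⟩
  refine tendsto_const_nhds.congr' ?_
  filter_upwards [eventually_ge_atTop n] with m hnm
  have hle : birkhoffSum T g n ≤ partialSups (birkhoffSum T g) m := le_partialSups_of_le _ hnm
  exact (Set.indicator_of_mem (s := {y | 0 < partialSups (birkhoffSum T g) m y})
    (hn.trans_le (hle x)) g).symm

theorem measurable_birkhoffLimsup (hT : Measurable T) (hg : Measurable g) :
    Measurable (birkhoffLimsup T g) :=
  Measurable.limsup fun n => (measurable_birkhoffSum hT hg n).const_mul ((n : ℝ)⁻¹)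

variable [IsFiniteMeasure μ]

theorem integrable_birkhoffLimsup (hT : Measurable T) (hgm : Measurable g)
    (hC : ∀ x, |g x| ≤ C) : Integrable (birkhoffLimsup T g) μ :=
  .of_bound (measurable_birkhoffLimsup hT hgm).aestronglyMeasurable C
    (Eventually.of_forall (abs_birkhoffLimsup_le hC))

theorem integral_birkhoffLimsup_le (hT : MeasurePreserving T μ μ) (hgm : Measurable g)
    (hC : ∀ x, |g x| ≤ C) : ∫ x, birkhoffLimsup T g x ∂μ ≤ ∫ x, g x ∂μ := by
  have hg : Integrable g μ := .of_bound hgm.aestronglyMeasurable C (Eventually.of_forall hC)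
  have hlim : Integrable (birkhoffLimsup T g) μ := integrable_birkhoffLimsup hT.measurable hgm hC
  have hbound (ε : ℝ) (hε : 0 < ε) :
      ∫ x, birkhoffLimsup T g x ∂μ ≤ (∫ x, g x ∂μ) + ε * μ.real Set.univ := by
    have h := integral_nonneg_of_exists_birkhoffSum_pos hT
      (hgm.sub ((measurable_birkhoffLimsup hT.measurable hgm).sub_const ε))
      (hg.sub (hlim.sub (integrable_const ε)))
      (Eventually.of_forall (exists_birkhoffSum_sub_birkhoffLimsup_pos hC hε))
    have hsub := integral_sub hg (hlim.sub (integrable_const ε))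
    have hsub' := integral_sub hlim (integrable_const (μ := μ) ε)
    rw [integral_const, smul_eq_mul] at hsub'
    simp only [Pi.sub_apply] at h hsub hsub'
    linarith
  have htend : Tendsto (fun ε : ℝ => (∫ x, g x ∂μ) + ε * μ.real Set.univ) (𝓝[>] 0)
      (𝓝 (∫ x, g x ∂μ)) :=
    tendsto_nhdsWithin_of_tendsto_nhds
      (Continuous.tendsto' (by fun_prop) _ _ (by rw [zero_mul, add_zero]))
  exact ge_of_tendsto htend (eventually_mem_nhdsWithin.mono hbound)

theorem le_integral_neg_birkhoffLimsup_neg (hT : MeasurePreserving T μ μ) (hgm : Measurable g)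
    (hC : ∀ x, |g x| ≤ C) : ∫ x, g x ∂μ ≤ ∫ x, -birkhoffLimsup T (-g) x ∂μ := by
  have h := integral_birkhoffLimsup_le hT hgm.neg fun x => (abs_neg (g x)).trans_le (hC x)
  simp only [Pi.neg_apply, integral_neg] at h ⊢
  linarith

theorem integral_birkhoffLimsup (hT : MeasurePreserving T μ μ) (hgm : Measurable g)
    (hC : ∀ x, |g x| ≤ C) : ∫ x, birkhoffLimsup T g x ∂μ = ∫ x, g x ∂μ := by
  have hC' : ∀ x, |(-g) x| ≤ C := fun x => (abs_neg (g x)).trans_le (hC x)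
  refine le_antisymm (integral_birkhoffLimsup_le hT hgm hC)
    ((le_integral_neg_birkhoffLimsup_neg hT hgm hC).trans ?_)
  exact integral_mono (integrable_birkhoffLimsup hT.measurable hgm.neg hC').neg
    (integrable_birkhoffLimsup hT.measurable hgm hC) (neg_birkhoffLimsup_neg_le hC)

theorem neg_birkhoffLimsup_neg_ae_eq (hT : MeasurePreserving T μ μ) (hgm : Measurable g)
    (hC : ∀ x, |g x| ≤ C) : (fun x => -birkhoffLimsup T (-g) x) =ᵐ[μ] birkhoffLimsup T g := by
  have hC' : ∀ x, |(-g) x| ≤ C := fun x => (abs_neg (g x)).trans_le (hC x)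
  have hlim := integrable_birkhoffLimsup (μ := μ) hT.measurable hgm hC
  have hlim' := (integrable_birkhoffLimsup (μ := μ) hT.measurable hgm.neg hC').neg
  refine (integral_eq_iff_of_ae_le hlim' hlim
    (Eventually.of_forall (neg_birkhoffLimsup_neg_le hC))).1 (le_antisymm ?_ ?_)
  · exact integral_mono hlim' hlim (neg_birkhoffLimsup_neg_le hC)
  · exact (integral_birkhoffLimsup_le hT hgm hC).trans
      (le_integral_neg_birkhoffLimsup_neg hT hgm hC)

theorem ae_tendsto_birkhoffAverage (hT : MeasurePreserving T μ μ) (hgm : Measurable g)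
    (hC : ∀ x, |g x| ≤ C) :
    ∀ᵐ x ∂μ, Tendsto (fun n => birkhoffAverage ℝ T g n x) atTop (𝓝 (birkhoffLimsup T g x)) := by
  filter_upwards [neg_birkhoffLimsup_neg_ae_eq hT hgm hC] with x hx
  rw [neg_birkhoffLimsup_neg hC] at hx
  exact tendsto_of_liminf_eq_limsup hx rfl (isBoundedUnder_le_birkhoffAverage hC x)
    (isBoundedUnder_ge_birkhoffAverage hC x)

theorem birkhoffLimsup_ae_eq_average [NeZero μ] (hT : MeasurePreserving T μ μ)
    (hT' : PreErgodic T μ) (hgm : Measurable g) (hC : ∀ x, |g x| ≤ C) :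
    ∀ᵐ x ∂μ, birkhoffLimsup T g x = ⨍ y, g y ∂μ := by
  obtain ⟨c, hc⟩ := hT'.ae_eq_const_of_ae_eq_comp (measurable_birkhoffLimsup hT.measurable hgm)
    (funext (birkhoffLimsup_apply_map hC))
  have havg : ⨍ y, birkhoffLimsup T g y ∂μ = c := by
    rw [average_congr hc]
    exact average_const μ c
  filter_upwards [hc] with x hx
  rw [hx, average_eq, ← integral_birkhoffLimsup hT hgm hC, ← average_eq, havg]
  rfl

end BirkhoffTheorem

section MeasurePreservingInvolutions

variable {X Y ι : Type*} [MeasurableSpace X] [MeasurableSpace Y] [Countable ι] {μ : Measure X}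
  {ν : Measure Y} {f : X → Y} {P : ι → Set X} {s : Set X}

/-- An involution `K` with `f ∘ K = f` maps every part of `s` on which `f` and `f ∘ K` preserve the
measure of images to a part with the same image under `f`. -/
theorem measurePreserving_restrict_of_involution {K : X → X} (hP : ∀ i, MeasurableSet (P i))
    (hf : ∀ i, ∀ E ⊆ P i, MeasurableSet E → ν (f '' E) = μ E) (hs : MeasurableSet s)
    (hsP : s ⊆ ⋃ i, P i) (hK : Measurable K) (hKs : Set.MapsTo K s s)
    (hKK : ∀ x ∈ s, K (K x) = x) (hfK : ∀ x ∈ s, f (K x) = f x) :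
    MeasurePreserving K (μ.restrict s) (μ.restrict s) := by
  refine ⟨hK, ?_⟩
  let U : Option (ι × ι) → Set X := fun i => i.elim sᶜ fun ij => s ∩ (P ij.1 ∩ K ⁻¹' P ij.2)
  have hU : ⋃ i, U i = Set.univ := by
    refine Set.eq_univ_of_forall fun x => Set.mem_iUnion.2 ?_
    by_cases hx : x ∈ s
    · obtain ⟨i, hi⟩ := Set.mem_iUnion.1 (hsP hx)
      obtain ⟨j, hj⟩ := Set.mem_iUnion.1 (hsP (hKs hx))
      exact ⟨some (i, j), hx, hi, hj⟩
    · exact ⟨none, hx⟩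
  have hUm : ∀ i, MeasurableSet (U i)
    | none => hs.compl
    | some ij => hs.inter ((hP ij.1).inter (hK (hP ij.2)))
  refine Measure.ext_of_iUnion_eq_univ hU fun i => Measure.ext fun A hA => ?_
  have hAU := hA.inter (hUm i)
  rw [Measure.restrict_apply hA, Measure.restrict_apply hA, Measure.map_apply hK hAU,
    Measure.restrict_apply (hK hAU), Measure.restrict_apply hAU]
  obtain _ | ⟨i, j⟩ := i
  · have hpre : K ⁻¹' (A ∩ U none) ∩ s = ∅ :=
      Set.eq_empty_of_forall_notMem fun x hx => hx.1.2 (hKs hx.2)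
    have hdisj : A ∩ U none ∩ s = ∅ := Set.eq_empty_of_forall_notMem fun x hx => hx.1.2 hx.2
    rw [hpre, hdisj]
  · have himage : f '' (K ⁻¹' (A ∩ U (some (i, j))) ∩ s) = f '' (A ∩ U (some (i, j)) ∩ s) := by
      refine Set.Subset.antisymm ?_ ?_
      · rintro _ ⟨x, ⟨hx, hxs⟩, rfl⟩
        exact ⟨K x, ⟨hx, hKs hxs⟩, hfK x hxs⟩
      · rintro _ ⟨x, ⟨hx, hxs⟩, rfl⟩
        exact ⟨K x, ⟨by rwa [Set.mem_preimage, hKK x hxs], hKs hxs⟩, hfK x hxs⟩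
    rw [← hf j _ (fun x hx => ?_) ((hK hAU).inter hs), himage,
      hf i _ (fun x hx => hx.1.2.2.1) (hAU.inter hs)]
    rw [← hKK x hx.2]
    exact hx.1.2.2.2

theorem setIntegral_eq_of_add_comp_eq {f : X → ℝ} {K : X → X} {A : Set X} {c : ℝ}
    (hK : MeasurePreserving K μ μ) (hA : MeasurableSet A) (hKA : K ⁻¹' A =ᵐ[μ] A)
    (hf : IntegrableOn f A μ) (h : ∀ᵐ x ∂μ.restrict A, f x + f (K x) = c) :
    ∫ x in A, f x ∂μ = c / 2 * μ.real A := by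
  have hKA' : MeasurePreserving K (μ.restrict A) (μ.restrict A) := by
    simpa only [Measure.restrict_congr_set hKA] using hK.restrict_preimage hA
  have hcomp : ∫ x in A, f (K x) ∂μ = ∫ x in A, f x ∂μ := by
    have := integral_map hKA'.aemeasurable (by rw [hKA'.map_eq]; exact hf.aestronglyMeasurable)
    rw [← this, hKA'.map_eq]
  have hadd : (∫ x in A, f x ∂μ) + ∫ x in A, f (K x) ∂μ = c * μ.real A := by
    have hadd := integral_add hf (hKA'.integrable_comp_of_integrable hf)
    simp only [Function.comp_apply] at hadd
    rw [← hadd, integral_congr_ae h, setIntegral_const, smul_eq_mul, mul_comm]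
  linarith

theorem measurableSet_setOf_exists_of_unique [MeasurableSpace.CountablySeparated X]
    [StandardBorelSpace (X × Y)] {R : Set (X × Y)} (hR : MeasurableSet R)
    (huniq : ∀ x y y', (x, y) ∈ R → (x, y') ∈ R → y = y') :
    MeasurableSet {x | ∃ y, (x, y) ∈ R} := by
  have hinj : Set.InjOn Prod.fst R := by
    rintro ⟨x, y⟩ hxy ⟨_, y'⟩ hxy' rfl
    rw [huniq x y y' hxy hxy']
  convert! hR.image_of_measurable_injOn measurable_fst hinj using 1
  ext x
  simp

end MeasurePreservingInvolutions

section PeriodicReduction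

variable {p : ℝ} (hp : 0 < p)

theorem measurable_toIcoMod_zero : Measurable (toIcoMod hp 0) := by
  rw [show toIcoMod hp 0 = fun x => Int.fract (x / p) * p from
    funext fun x => toIcoMod_eq_fract_mul hp x]
  fun_prop

theorem toIcoMod_toIcoMod_add (a x y : ℝ) :
    toIcoMod hp a (toIcoMod hp a x + y) = toIcoMod hp a (x + y) :=
  (toIcoMod_eq_toIcoMod hp).2 ⟨toIcoDiv hp a x, by rw [toIcoMod]; ring⟩

theorem toIcoMod_toIcoMod_sub (a x y : ℝ) :
    toIcoMod hp a (toIcoMod hp a x - y) = toIcoMod hp a (x - y) := by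
  simpa only [sub_eq_add_neg] using toIcoMod_toIcoMod_add hp a x (-y)

theorem setLIntegral_toIcoMod_sub (h : ℝ → ENNReal) (τ : ℝ) :
    ∫⁻ x in Set.Ico 0 p, h (toIcoMod hp 0 (x - τ)) = ∫⁻ x in Set.Ico 0 p, h x := by
  have hper : Function.Periodic (fun x => h (toIcoMod hp 0 x)) p := fun x => by
    simp only [toIcoMod_add_right]
  have hpre : (fun x => x - τ) ⁻¹' Set.Ico (-τ) (-τ + p) = Set.Ico 0 p := by
    ext x
    simp only [Set.mem_preimage, Set.mem_Ico]
    constructor <;> rintro ⟨h₁, h₂⟩ <;> constructor <;> linarith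
  calc ∫⁻ x in Set.Ico 0 p, h (toIcoMod hp 0 (x - τ))
      = ∫⁻ x in Set.Ico (-τ) (-τ + p), h (toIcoMod hp 0 x) := by
        rw [← (measurePreserving_sub_right volume τ).setLIntegral_comp_preimage_emb
          (MeasurableEquiv.subRight τ).measurableEmbedding (fun x => h (toIcoMod hp 0 x)), hpre]
    _ = ∫⁻ x in Set.Ioc 0 p, h (toIcoMod hp 0 x) := by
        have hshift := (isAddFundamentalDomain_Ioc hp (-τ)).setLIntegral_eq
          (isAddFundamentalDomain_Ioc hp 0) (fun x => h (toIcoMod hp 0 x)) hper.map_vadd_zmultiples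
        rw [setLIntegral_congr Ico_ae_eq_Ioc, hshift, zero_add]
    _ = ∫⁻ x in Set.Ico 0 p, h x := by
        rw [← setLIntegral_congr Ico_ae_eq_Ioc]
        refine setLIntegral_congr_fun measurableSet_Ico fun x hx => ?_
        simp only [(toIcoMod_eq_self hp).2 ((zero_add p).symm ▸ hx)]

theorem setLIntegral_Ioo_sub_left (p : ℝ) (h : ℝ → ENNReal) :
    ∫⁻ x in Set.Ioo 0 p, h (p - x) = ∫⁻ x in Set.Ioo 0 p, h x := by
  have hpre : (fun x => p - x) ⁻¹' Set.Ioo 0 p = Set.Ioo 0 p := by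
    rw [Set.preimage_const_sub_Ioo, sub_self, sub_zero]
  have h := (Measure.measurePreserving_sub_left volume p).setLIntegral_comp_preimage_emb
    (MeasurableEquiv.subLeft p).measurableEmbedding h (Set.Ioo 0 p)
  rwa [hpre] at h

end PeriodicReduction

section PeriodicCurves

variable {E : Type*} [TopologicalSpace E] [T2Space E] {f : ℝ → E} {p : ℝ}

theorem nhdsWithin_range_le_map_of_periodic (hf : Continuous f) (hper : f.Periodic p) (hp : 0 < p)
    (hinj : Set.InjOn f (Set.Ico 0 p)) (s : ℝ) : 𝓝[Set.range f] (f s) ≤ map f (𝓝 s) := by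
  have : Fact (0 < p) := ⟨hp⟩
  set F : AddCircle p → E := hper.lift
  have hFinj : Function.Injective F := fun x y hxy => by
    have hx := AddCircle.coe_equivIco (a := 0) (y := x)
    have hy := AddCircle.coe_equivIco (a := 0) (y := y)
    have hmem (z : AddCircle p) : (AddCircle.equivIco p 0 z : ℝ) ∈ Set.Ico 0 p := by
      simpa only [zero_add] using (AddCircle.equivIco p 0 z).2
    rw [← hx, ← hy] at hxy ⊢
    rw [hinj (hmem x) (hmem y) hxy]
  have hF : IsClosedEmbedding F :=
    Continuous.isClosedEmbedding (continuous_coinduced_dom.2 hf) hFinj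
  have hrange : Set.range f = Set.range F := (Set.range_quot_lift _).symm
  calc 𝓝[Set.range f] (f s) = map F (𝓝 (s : AddCircle p)) := by
        rw [hrange, hF.isEmbedding.map_nhds_eq]; rfl
    _ ≤ map F (map (↑) (𝓝 s)) := map_mono (QuotientAddGroup.isOpenMap_coe.nhds_le s)
    _ = map f (𝓝 s) := rfl

end PeriodicCurves

section Frontiers

theorem subset_of_isPreconnected_of_disjoint_frontier {X : Type*} [TopologicalSpace X]
    {S U : Set X} (hS : IsPreconnected S) (hU : IsOpen U) (hfr : Disjoint S (frontier U))
    (h : (S ∩ U).Nonempty) : S ⊆ U := by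
  refine hS.subset_left_of_subset_union hU isClosed_closure.isOpen_compl
    (Set.disjoint_compl_right_iff_subset.2 subset_closure) (fun x hx => ?_) h
  have hx' := Set.disjoint_left.1 hfr hx
  rw [hU.frontier_eq, Set.mem_sdiff, not_and_not_right] at hx'
  exact (em (x ∈ closure U)).imp hx' id

variable {E : Type*} [NormedAddCommGroup E] [NormedSpace ℝ E] {U : Set E}

theorem exists_first_exit_of_isBounded (hU : IsOpen U) (hb : Bornology.IsBounded U) {x v : E}
    (hv : v ≠ 0) (hx : ∀ᶠ r : ℝ in 𝓝[>] 0, x + r • v ∈ U) :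
    ∃ t : ℝ, 0 < t ∧ x + t • v ∈ frontier U ∧ ∀ r ∈ Set.Ioo 0 t, x + r • v ∈ U := by
  obtain ⟨ε, hε, hεU⟩ := mem_nhdsGT_iff_exists_Ioo_subset.1 hx
  have hcont : Continuous fun r : ℝ => x + r • v := by fun_prop
  set A := Set.Ici ε ∩ (fun r : ℝ => x + r • v) ⁻¹' Uᶜ
  have hAne : A.Nonempty := by
    obtain ⟨R, hR⟩ := hb.subset_ball x
    refine ⟨max ε (R / ‖v‖), Set.mem_Ici.2 (le_max_left _ _), fun hmem => ?_⟩
    have hlt := hR hmem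
    rw [mem_ball_iff_norm, add_sub_cancel_left, norm_smul, Real.norm_eq_abs,
      ← lt_div_iff₀ (norm_pos_iff.2 hv)] at hlt
    exact ((le_max_right _ _).trans (le_abs_self _)).not_gt hlt
  have hAbdd : BddBelow A := ⟨ε, fun r hr => hr.1⟩
  obtain ⟨hεt, htU⟩ : sInf A ∈ A :=
    (isClosed_Ici.inter (hU.isClosed_compl.preimage hcont)).csInf_mem hAne hAbdd
  have ht : 0 < sInf A := lt_of_lt_of_le hε hεt
  have hin : ∀ r ∈ Set.Ioo 0 (sInf A), x + r • v ∈ U := fun r hr => by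
    rcases lt_or_ge r ε with h | h
    · exact hεU ⟨hr.1, h⟩
    · by_contra hrU
      exact (csInf_le hAbdd ⟨h, hrU⟩).not_gt hr.2
  refine ⟨sInf A, ht, hU.frontier_eq ▸ ⟨?_, htU⟩, hin⟩
  refine map_mem_closure (f := fun r : ℝ => x + r • v) hcont ?_ hin
  exact closure_Ioo ht.ne ▸ Set.right_mem_Icc.2 ht.le

theorem measurableSet_setOf_openSegment_subset [MeasurableSpace E] [BorelSpace E]
    [SecondCountableTopology E] (hU : IsOpen U) :
    MeasurableSet {p : E × E | openSegment ℝ p.1 p.2 ⊆ U} := by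
  have hseg (p : E × E) : openSegment ℝ p.1 p.2 ⊆ U ↔
      ∀ n : ℕ, ∀ r ∈ Set.Icc (1 / (n + 1) : ℝ) (1 - 1 / (n + 1)), p.1 + r • (p.2 - p.1) ∈ U := by
    rw [openSegment_eq_image', Set.image_subset_iff]
    refine ⟨fun h n r hr => h ?_, fun h r hr => ?_⟩
    · have hn : (0 : ℝ) < 1 / (n + 1) := Nat.one_div_pos_of_nat
      exact ⟨by linarith [hr.1], by linarith [hr.2]⟩
    · obtain ⟨n, hn⟩ := exists_nat_one_div_lt (lt_min hr.1 (sub_pos.2 hr.2))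
      exact h n r ⟨(hn.trans_le (min_le_left _ _)).le,
        by linarith [hn.trans_le (min_le_right r (1 - r))]⟩
  simp_rw [hseg]
  rw [Set.ofPred_forall]
  refine MeasurableSet.iInter fun n => IsOpen.measurableSet (isOpen_iff_mem_nhds.2 fun p hp => ?_)
  refine isCompact_Icc.eventually_forall_of_forall_eventually (x₀ := p)
    (P := fun (p : E × E) (r : ℝ) => p.1 + r • (p.2 - p.1) ∈ U) fun r hr => ?_
  have hcont : Continuous fun z : (E × E) × ℝ => z.1.1 + z.2 • (z.1.2 - z.1.1) := by fun_prop
  exact (hU.preimage hcont).mem_nhds (hp r hr)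

theorem exists_eq_add_smul_and_forall_mem_iff {a b v : E} (hv : ‖v‖ = 1) :
    (∃ t : ℝ, 0 < t ∧ b = a + t • v ∧ ∀ r ∈ Set.Ioo 0 t, a + r • v ∈ U) ↔
      b ≠ a ∧ b - a = ‖b - a‖ • v ∧ openSegment ℝ a b ⊆ U := by
  rw [openSegment_eq_image', Set.image_subset_iff]
  constructor
  · rintro ⟨t, ht, rfl, h⟩
    have hn : ‖t • v‖ = t := by rw [norm_smul, hv, mul_one, Real.norm_of_nonneg ht.le]
    simp only [ne_eq, add_eq_left, add_sub_cancel_left, hn, true_and]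
    refine ⟨norm_ne_zero_iff.1 (hn.symm ▸ ht.ne'), fun r hr => ?_⟩
    rw [Set.mem_preimage, smul_smul]
    exact h _ ⟨mul_pos hr.1 ht, mul_lt_of_lt_one_left ht hr.2⟩
  · rintro ⟨hne, hb, h⟩
    have hpos : 0 < ‖b - a‖ := norm_pos_iff.2 (sub_ne_zero.2 hne)
    refine ⟨‖b - a‖, hpos, by rw [← hb, add_sub_cancel], fun r hr => ?_⟩
    have hmem := h ⟨div_pos hr.1 hpos, (div_lt_one hpos).2 hr.2⟩
    rwa [Set.mem_preimage, hb, smul_smul, norm_smul, norm_norm, hv, mul_one,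
      div_mul_cancel₀ _ hpos.ne'] at hmem

end Frontiers

section ConesAtSmoothPoints

variable {E : Type*} [NormedAddCommGroup E] [NormedSpace ℝ E] (ℓ : E →L[ℝ] ℝ)

theorem isLittleO_apply_sub_of_hasDerivAt {γ : ℝ → E} {e : E} {s : ℝ} (h : HasDerivAt γ e s)
    (he : e ≠ 0) (hℓ : ℓ e = 0) :
    (fun t => ℓ (γ t - γ s)) =o[𝓝 s] fun t => γ t - γ s := by
  have htaylor : (fun t => ℓ (γ t - γ s - (t - s) • e)) =o[𝓝 s] fun t => t - s :=
    (ℓ.isBigO_comp _ _).trans_isLittleO (hasDerivAt_iff_isLittleO.1 h)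
  simp only [map_sub, map_smul, hℓ, smul_zero, sub_zero] at htaylor
  simp only [map_sub]
  exact htaylor.trans_isBigO <| (h.isTheta_sub he).isBigO_symm.comp_tendsto
    (prod_pure (f := 𝓝 s) ▸ tendsto_map)

variable {ℓ}

theorem eventually_forall_add_smul_notMem_of_isLittleO {S K : Set E} {x : E}
    (h : (fun y => ℓ (y - x)) =o[𝓝[S] x] fun y => y - x) (hK : IsCompact K)
    (hℓ : ∀ w ∈ K, ℓ w ≠ 0) : ∀ᶠ r : ℝ in 𝓝[>] 0, ∀ w ∈ K, x + r • w ∉ S := by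
  refine eventually_nhdsWithin_iff.2 <| (hK.eventually_forall_of_forall_eventually (x₀ := (0 : ℝ))
    (P := fun r w => 0 < r → x + r • w ∉ S) fun w hw => ?_).mono fun r hr hr0 w hw => hr w hw hr0
  obtain ⟨c, hc, hcw⟩ := exists_pos_mul_lt (abs_pos.2 (hℓ w hw)) ‖w‖
  have hcone : ∀ᶠ y in 𝓝 x, y ∈ S → |ℓ (y - x)| ≤ c * ‖y - x‖ :=
    eventually_nhdsWithin_iff.1 (h.def hc)
  have htendsto : Tendsto (fun z : ℝ × E => x + z.1 • z.2) (𝓝 (0, w)) (𝓝 x) := by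
    have hcont : Continuous fun z : ℝ × E => x + z.1 • z.2 := by fun_prop
    simpa only [zero_smul, add_zero] using hcont.tendsto (0, w)
  have hsteep : ∀ᶠ z : ℝ × E in 𝓝 (0, w), ‖z.2‖ * c < |ℓ z.2| :=
    (by fun_prop : Continuous fun z : ℝ × E => ‖z.2‖ * c).continuousAt.eventually_lt
      (by fun_prop : Continuous fun z : ℝ × E => |ℓ z.2|).continuousAt hcw
  filter_upwards [htendsto.eventually hcone, hsteep] with z hz hzw hz0 hzS
  have hle := hz hzS
  rw [add_sub_cancel_left, map_smul, smul_eq_mul, abs_mul, norm_smul, Real.norm_eq_abs,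
    mul_left_comm, mul_le_mul_iff_of_pos_left (abs_pos.2 hz0.ne'), mul_comm] at hle
  exact hle.not_gt hzw

theorem eventually_add_smul_mem_imp_of_isLittleO {U : Set E} (hU : IsOpen U) {x a b : E}
    (h : (fun y => ℓ (y - x)) =o[𝓝[frontier U] x] fun y => y - x) (hab : 0 < ℓ a * ℓ b) :
    ∀ᶠ r : ℝ in 𝓝[>] 0, x + r • a ∈ U → x + r • b ∈ U := by
  have hside : segment ℝ a b ⊆ {w | 0 < ℓ a * ℓ w} :=
    ((convex_Ioi (0 : ℝ)).linear_preimage (ℓ a • ℓ : E →L[ℝ] ℝ).toLinearMap).segment_subset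
      (mul_self_pos.2 (left_ne_zero_of_mul hab.ne')) hab
  have hcompact : IsCompact (segment ℝ a b) :=
    convexHull_pair (𝕜 := ℝ) a b ▸ (Set.toFinite {a, b}).isCompact_convexHull ℝ
  filter_upwards [eventually_forall_add_smul_notMem_of_isLittleO h
    hcompact fun w hw => right_ne_zero_of_mul (hside hw).ne'] with r hr ha
  have hsub : (fun w => x + r • w) '' segment ℝ a b ⊆ U :=
    subset_of_isPreconnected_of_disjoint_frontier
      ((convex_segment a b).isPreconnected.image _ (by fun_prop)) hU
      (Set.disjoint_left.2 (Set.forall_mem_image.2 hr))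
      ⟨_, Set.mem_image_of_mem _ (left_mem_segment ℝ a b), ha⟩
  exact hsub (Set.mem_image_of_mem _ (right_mem_segment ℝ a b))

end ConesAtSmoothPoints

attribute [local instance] Complex.finrank_real_complex_fact

local notation "ω" => Complex.orientation.areaForm'

theorem areaForm'_eq_im_conj_mul (w z : ℂ) : ω w z = (starRingEnd ℂ w * z).im :=
  Complex.areaForm w z

theorem areaForm'_self (w : ℂ) : ω w w = 0 :=
  Complex.orientation.areaForm_apply_self w

theorem areaForm'_swap (w z : ℂ) : ω w z = -ω z w :=
  Complex.orientation.areaForm_swap w z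

namespace BilliardTable

section FrontierAtSmoothPoints

variable {q : ℕ} (T : BilliardTable q)

variable {T} in
theorem hasDerivAt_γ {α : Fin q} {s : ℝ} (h : ContDiffAt ℝ 1 (T.γ α) s) :
    HasDerivAt (T.γ α) (deriv (T.γ α) s) s :=
  (h.differentiableAt one_ne_zero).hasDerivAt

variable {T} in
theorem deriv_γ_ne_zero {α : Fin q} {s : ℝ} (h : ContDiffAt ℝ 1 (T.γ α) s) :
    deriv (T.γ α) s ≠ 0 := by
  rw [← norm_ne_zero_iff, T.unit_speed α s h]
  exact one_ne_zero

theorem isClosed_range_γ (α : Fin q) : IsClosed (Set.range (T.γ α)) :=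
  ((T.periodic α).compact_of_continuous (T.L_pos α).ne' (T.continuous α)).isClosed

theorem nhdsWithin_frontier_le_map (α : Fin q) (s : ℝ) :
    𝓝[frontier T.Ω] (T.γ α s) ≤ map (T.γ α) (𝓝 s) := by
  rw [T.frontier_eq, nhdsWithin_iUnion]
  refine iSup_le fun β => ?_
  rcases eq_or_ne β α with rfl | hβ
  · exact nhdsWithin_range_le_map_of_periodic (T.continuous β) (T.periodic β) (T.L_pos β)
      (T.injOn β) s
  · have hs : T.γ α s ∉ closure (Set.range (T.γ β)) := fun hmem =>
      Set.disjoint_left.1 (T.disjoint hβ) ((T.isClosed_range_γ β).closure_eq ▸ hmem) ⟨s, rfl⟩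
    rw [notMem_closure_iff_nhdsWithin_eq_bot.1 hs]
    exact bot_le

variable {T} {α : Fin q} {s : ℝ}

theorem isLittleO_areaForm_frontier (h : ContDiffAt ℝ 1 (T.γ α) s) :
    (fun x => ω (deriv (T.γ α) s) (x - T.γ α s)) =o[𝓝[frontier T.Ω] (T.γ α s)]
      fun x => x - T.γ α s := by
  have hcurve := isLittleO_apply_sub_of_hasDerivAt (ω (deriv (T.γ α) s)) (hasDerivAt_γ h)
    (deriv_γ_ne_zero h) (areaForm'_self _)
  exact (Asymptotics.isLittleO_map.2 hcurve).mono (T.nhdsWithin_frontier_le_map α s)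

theorem areaForm_deriv_γ_normal (h : ContDiffAt ℝ 1 (T.γ α) s) :
    ω (deriv (T.γ α) s) (Complex.I * deriv (T.γ α) s) = 1 := by
  rw [areaForm'_eq_im_conj_mul, mul_left_comm, Complex.conj_mul', T.unit_speed α s h]
  simp

theorem eventually_mem_Ω (h : ContDiffAt ℝ 1 (T.γ α) s) {u : ℂ} (hu : 0 < ω (deriv (T.γ α) s) u) :
    ∀ᶠ r : ℝ in 𝓝[>] 0, T.γ α s + r • u ∈ T.Ω := by
  have himp := eventually_add_smul_mem_imp_of_isLittleO T.isOpen (b := u)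
    (isLittleO_areaForm_frontier h) (by rwa [areaForm_deriv_γ_normal h, one_mul])
  filter_upwards [himp, T.left_mem α s h] with r hr hmem using hr (by rwa [Complex.real_smul])

theorem eventually_notMem_Ω (h : ContDiffAt ℝ 1 (T.γ α) s) {u : ℂ}
    (hu : ω (deriv (T.γ α) s) u < 0) : ∀ᶠ r : ℝ in 𝓝[>] 0, T.γ α s + r • u ∉ T.Ω := by
  have himp := eventually_add_smul_mem_imp_of_isLittleO T.isOpen
    (a := u) (b := -(Complex.I * deriv (T.γ α) s)) (isLittleO_areaForm_frontier h)
    (by rwa [map_neg, areaForm_deriv_γ_normal h, mul_neg_one, neg_pos])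
  filter_upwards [himp, T.right_notMem α s h] with r hr hnot hmem
  exact hnot (by simpa only [smul_neg, ← sub_eq_add_neg, Complex.real_smul] using hr hmem)

end FrontierAtSmoothPoints

section BilliardMap

variable {q : ℕ}

/-- The reversal of the motion at a footpoint: the outgoing velocity of `reverse z` is opposite to
the velocity with which an orbit arrives before it is reflected to `z`. -/
def reverse (z : Fin q × ℝ × ℝ) : Fin q × ℝ × ℝ := (z.1, z.2.1, Real.pi - z.2.2)

theorem reverse_reverse (z : Fin q × ℝ × ℝ) : reverse (reverse z) = z := by
  simp [reverse]

theorem measurable_reverse : Measurable (reverse (q := q)) := by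
  unfold reverse
  fun_prop

variable (T : BilliardTable q)

/-- The positive unit tangent at the footpoint. -/
def tangent (z : Fin q × ℝ × ℝ) : ℂ := deriv (T.γ z.1) z.2.1

theorem reverse_mem_phaseSpace {z : Fin q × ℝ × ℝ} :
    reverse z ∈ T.phaseSpace ↔ z ∈ T.phaseSpace := by
  simp only [phaseSpace, reverse, Set.mem_ofPred_eq, Set.mem_Ioo, sub_pos, sub_lt_self_iff]
  tauto

theorem direction_reverse (z : Fin q × ℝ × ℝ) :
    T.direction (reverse z) (reverse z).2.2 = -T.direction z (-z.2.2) := by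
  simp only [direction, reverse, Complex.ofReal_sub, Complex.ofReal_neg, sub_mul, neg_mul,
    Complex.exp_sub, Complex.exp_neg, Complex.exp_pi_mul_I]
  ring

theorem direction_reverse_neg (z : Fin q × ℝ × ℝ) :
    T.direction (reverse z) (-(reverse z).2.2) = -T.direction z z.2.2 := by
  rw [← neg_eq_iff_eq_neg, ← direction_reverse, reverse_reverse]

theorem footpoint_notMem_Ω (z : Fin q × ℝ × ℝ) : T.footpoint z ∉ T.Ω := fun h =>
  Set.disjoint_left.1 (disjoint_frontier_iff_isOpen.2 T.isOpen)
    (T.frontier_eq ▸ Set.mem_iUnion.2 ⟨z.1, z.2.1, rfl⟩) h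

theorem eq_and_eq_of_γ_eq {α β : Fin q} {s t : ℝ} (hs : s ∈ Set.Ico 0 (T.L α))
    (ht : t ∈ Set.Ico 0 (T.L β)) (h : T.γ α s = T.γ β t) : α = β ∧ s = t := by
  obtain rfl : α = β := by
    by_contra hne
    exact Set.disjoint_left.1 (T.disjoint hne) ⟨s, rfl⟩ ⟨t, h.symm⟩
  exact ⟨rfl, T.injOn α hs ht h⟩

variable {T} {z w w' : Fin q × ℝ × ℝ}

theorem norm_direction (h : T.IsRegular z) (θ : ℝ) : ‖T.direction z θ‖ = 1 := by
  rw [direction, norm_mul, T.unit_speed _ _ h, mul_one, Complex.norm_exp_ofReal_mul_I]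

theorem areaForm_tangent_direction (h : T.IsRegular z) (θ : ℝ) :
    ω (T.tangent z) (T.direction z θ) = Real.sin θ := by
  rw [areaForm'_eq_im_conj_mul, direction, tangent, mul_left_comm, Complex.conj_mul',
    T.unit_speed _ _ h, Complex.ofReal_one, one_pow, mul_one, Complex.exp_ofReal_mul_I_im]

theorem isNext_reverse (h : T.IsNext z w) : T.IsNext (reverse w) (reverse z) := by
  obtain ⟨hz, hw, hzr, hwr, ⟨t, ht, hfoot, hin⟩, hdir⟩ := h
  refine ⟨T.reverse_mem_phaseSpace.2 hw, T.reverse_mem_phaseSpace.2 hz, hwr, hzr,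
    ⟨t, ht, ?_, fun r hr => ?_⟩, by rw [direction_reverse, direction_reverse_neg, hdir]⟩
  · change T.footpoint z = T.footpoint w + _
    rw [direction_reverse, ← hdir, hfoot]
    ring
  · change T.footpoint w + _ ∈ _
    have hmem := hin (t - r) ⟨by linarith [hr.2], by linarith [hr.1]⟩
    convert! hmem using 1
    rw [direction_reverse, ← hdir, hfoot, Complex.ofReal_sub]
    ring

theorem eq_of_direction_neg_eq {α : Fin q} {s θ θ' : ℝ} (h : ContDiffAt ℝ 1 (T.γ α) s)
    (hθ : θ ∈ Set.Ioo 0 Real.pi) (hθ' : θ' ∈ Set.Ioo 0 Real.pi)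
    (heq : T.direction (α, s, θ) (-θ) = T.direction (α, s, θ') (-θ')) : θ = θ' := by
  have hexp := congrArg Complex.re (mul_right_cancel₀ (deriv_γ_ne_zero h) heq)
  rw [Complex.exp_ofReal_mul_I_re, Complex.exp_ofReal_mul_I_re, Real.cos_neg, Real.cos_neg] at hexp
  exact Real.injOn_cos (Set.Ioo_subset_Icc_self hθ) (Set.Ioo_subset_Icc_self hθ') hexp

theorem IsNext.unique (h : T.IsNext z w) (h' : T.IsNext z w') : w = w' := by
  obtain ⟨-, hw, -, hwr, ⟨t, ht, hfoot, hin⟩, hdir⟩ := h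
  obtain ⟨-, hw', -, -, ⟨t', ht', hfoot', hin'⟩, hdir'⟩ := h'
  obtain rfl : t = t' := by
    rcases lt_trichotomy t t' with hlt | heq | hlt
    · exact absurd (hfoot ▸ hin' t ⟨ht, hlt⟩) (T.footpoint_notMem_Ω w)
    · exact heq
    · exact absurd (hfoot' ▸ hin t' ⟨ht', hlt⟩) (T.footpoint_notMem_Ω w')
  obtain ⟨α, s, θ⟩ := w
  obtain ⟨α', s', θ'⟩ := w'
  obtain ⟨rfl : α = α', rfl : s = s'⟩ :=
    T.eq_and_eq_of_γ_eq hw.1 hw'.1 (hfoot.trans hfoot'.symm)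
  obtain rfl : θ = θ' := eq_of_direction_neg_eq hwr hw.2 hw'.2 (hdir.symm.trans hdir')
  rfl

theorem exists_mem_frontier_of_isRegular (hz : z ∈ T.phaseSpace) (hr : T.IsRegular z) :
    ∃ t : ℝ, 0 < t ∧ T.footpoint z + t • T.direction z z.2.2 ∈ frontier T.Ω ∧
      ∀ r ∈ Set.Ioo 0 t, T.footpoint z + r • T.direction z z.2.2 ∈ T.Ω := by
  refine exists_first_exit_of_isBounded T.isOpen T.isBounded ?_ (eventually_mem_Ω hr ?_)
  · rw [← norm_ne_zero_iff, norm_direction hr]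
    exact one_ne_zero
  · exact (areaForm_tangent_direction hr _).symm ▸ Real.sin_pos_of_mem_Ioo hz.2

theorem areaForm_nonpos_of_forall_mem {α : Fin q} {s t : ℝ} {x v : ℂ}
    (h : ContDiffAt ℝ 1 (T.γ α) s) (ht : 0 < t) (hs : T.γ α s = x + t • v)
    (hin : ∀ r ∈ Set.Ioo 0 t, x + r • v ∈ T.Ω) : ω (deriv (T.γ α) s) v ≤ 0 := by
  by_contra! hpos
  obtain ⟨r, hr, hrt⟩ := ((eventually_notMem_Ω h (u := -v) (by simpa using hpos)).and
    (Ioo_mem_nhdsGT ht)).exists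
  refine hr ?_
  convert! hin (t - r) ⟨by linarith [hrt.2], by linarith [hrt.1]⟩ using 1
  rw [hs]
  module

theorem exists_eq_exp_neg_mul {e v : ℂ} (he : ‖e‖ = 1) (hv : ‖v‖ = 1) (h : ω e v < 0) :
    ∃ θ ∈ Set.Ioo 0 Real.pi, v = Complex.exp (((-θ : ℝ) : ℂ) * Complex.I) * e := by
  set u := starRingEnd ℂ e * v
  have hu : Complex.exp (Complex.arg u * Complex.I) = u := by
    have hpolar := Complex.norm_mul_exp_arg_mul_I u
    rwa [norm_mul, RCLike.norm_conj, he, hv, one_mul, Complex.ofReal_one, one_mul] at hpolar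
  rw [areaForm'_eq_im_conj_mul] at h
  refine ⟨-Complex.arg u, ⟨neg_pos.2 (Complex.arg_neg_iff.2 h),
    neg_lt.1 (Complex.neg_pi_lt_arg u)⟩, ?_⟩
  rw [neg_neg, hu, mul_right_comm, Complex.conj_mul', he, Complex.ofReal_one, one_pow, one_mul]

theorem exists_isNext_or_exists_singular (hz : z ∈ T.phaseSpace) (hr : T.IsRegular z) :
    (∃ w, T.IsNext z w) ∨ ∃ (β : Fin q) (s t : ℝ), s ∈ Set.Ico 0 (T.L β) ∧
      T.γ β s = T.footpoint z + t • T.direction z z.2.2 ∧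
      (ContDiffAt ℝ 1 (T.γ β) s → ω (deriv (T.γ β) s) (T.direction z z.2.2) = 0) := by
  obtain ⟨t, ht, hfr, hin⟩ := exists_mem_frontier_of_isRegular hz hr
  rw [T.frontier_eq] at hfr
  obtain ⟨β, s', hs'⟩ := Set.mem_iUnion.1 hfr
  obtain ⟨s, hs, hss'⟩ := (T.periodic β).exists_mem_Ico₀ (T.L_pos β) s'
  rw [hss'] at hs'
  by_cases hsing : ContDiffAt ℝ 1 (T.γ β) s → ω (deriv (T.γ β) s) (T.direction z z.2.2) = 0
  · exact Or.inr ⟨β, s, t, hs, hs', hsing⟩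
  · obtain ⟨hreg, hne⟩ := Classical.not_imp.1 hsing
    obtain ⟨θ, hθ, hdir⟩ := exists_eq_exp_neg_mul (T.unit_speed β s hreg) (norm_direction hr _)
      (lt_of_le_of_ne (areaForm_nonpos_of_forall_mem hreg ht hs' hin) hne)
    exact Or.inl ⟨(β, s, θ), hz, ⟨hs, hθ⟩, hr, hreg, ⟨t, ht, hs', hin⟩, hdir⟩

variable (T)

theorem measurable_footpoint : Measurable T.footpoint :=
  measurable_from_prod_countable_right fun α => ((T.continuous α).measurable.comp measurable_fst :)

theorem measurable_tangent : Measurable T.tangent :=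
  measurable_from_prod_countable_right fun α => ((measurable_deriv (T.γ α)).comp measurable_fst :)

theorem measurable_direction {θ : Fin q × ℝ × ℝ → ℝ} (hθ : Measurable θ) :
    Measurable fun z => T.direction z (θ z) :=
  Measurable.mul (by fun_prop) T.measurable_tangent

theorem measurableSet_phaseSpace : MeasurableSet T.phaseSpace := by
  have hL : Measurable fun z : Fin q × ℝ × ℝ => T.L z.1 :=
    (measurable_of_countable T.L).comp measurable_fst
  exact ((measurableSet_le measurable_const measurable_snd.fst).inter
    (measurableSet_lt measurable_snd.fst hL)).inter (measurable_snd.snd measurableSet_Ioo)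

theorem measurableSet_contDiffAt (α : Fin q) : MeasurableSet {s | ContDiffAt ℝ 1 (T.γ α) s} :=
  (isOpen_iff_mem_nhds.2 fun _ hs => ContDiffAt.eventually hs (by simp)).measurableSet

theorem measurableSet_isRegular : MeasurableSet {z | T.IsRegular z} := by
  have hunion : {z | T.IsRegular z} = ⋃ α, {z : Fin q × ℝ × ℝ | z.1 = α} ∩
      (fun z => z.2.1) ⁻¹' {s | ContDiffAt ℝ 1 (T.γ α) s} := by
    ext z
    simp [IsRegular]
  rw [hunion]
  exact MeasurableSet.iUnion fun α => (measurable_fst (measurableSet_singleton α)).inter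
    (measurable_snd.fst (T.measurableSet_contDiffAt α))

theorem isNext_iff_openSegment_subset : T.IsNext z w ↔
    z ∈ T.phaseSpace ∧ w ∈ T.phaseSpace ∧ T.IsRegular z ∧ T.IsRegular w ∧
    T.footpoint w ≠ T.footpoint z ∧
    T.footpoint w - T.footpoint z = ‖T.footpoint w - T.footpoint z‖ • T.direction z z.2.2 ∧
    openSegment ℝ (T.footpoint z) (T.footpoint w) ⊆ T.Ω ∧
    T.direction z z.2.2 = T.direction w (-w.2.2) := by
  refine and_congr_right fun _ => and_congr_right fun _ => and_congr_right fun hr =>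
    and_congr_right fun _ => ?_
  simp only [← Complex.real_smul, exists_eq_add_smul_and_forall_mem_iff (norm_direction hr z.2.2),
    and_assoc]

theorem measurableSet_isNext :
    MeasurableSet {p : (Fin q × ℝ × ℝ) × (Fin q × ℝ × ℝ) | T.IsNext p.1 p.2} := by
  simp only [isNext_iff_openSegment_subset]
  have hz : Measurable fun p : (Fin q × ℝ × ℝ) × (Fin q × ℝ × ℝ) => T.footpoint p.1 :=
    T.measurable_footpoint.comp measurable_fst
  have hw : Measurable fun p : (Fin q × ℝ × ℝ) × (Fin q × ℝ × ℝ) => T.footpoint p.2 :=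
    T.measurable_footpoint.comp measurable_snd
  have hdz : Measurable fun p : (Fin q × ℝ × ℝ) × (Fin q × ℝ × ℝ) => T.direction p.1 p.1.2.2 :=
    (T.measurable_direction measurable_snd.snd).comp measurable_fst
  have hdw : Measurable fun p : (Fin q × ℝ × ℝ) × (Fin q × ℝ × ℝ) => T.direction p.2 (-p.2.2.2) :=
    (T.measurable_direction measurable_snd.snd.neg).comp measurable_snd
  exact (measurable_fst T.measurableSet_phaseSpace).inter <|
    (measurable_snd T.measurableSet_phaseSpace).inter <|
    (measurable_fst T.measurableSet_isRegular).inter <|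
    (measurable_snd T.measurableSet_isRegular).inter <|
    (measurableSet_eq_fun hw hz).compl.inter <|
    (measurableSet_eq_fun (hw.sub hz) ((hw.sub hz).norm.smul hdz)).inter <|
    ((hz.prodMk hw) (measurableSet_setOf_openSegment_subset T.isOpen)).inter
    (measurableSet_eq_fun hdz hdw)

/-- The phase points that have a successor. -/
def domain : Set (Fin q × ℝ × ℝ) := {z | ∃ w, T.IsNext z w}

variable {T} in
theorem isNext_billiardMap (h : z ∈ T.domain) : T.IsNext z (T.billiardMap z) := by
  have hex : ∃ w, T.IsNext z w := h
  rw [billiardMap, dif_pos hex]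
  exact hex.choose_spec

variable {T} in
theorem billiardMap_of_notMem (h : z ∉ T.domain) : T.billiardMap z = z :=
  dif_neg h

variable {T} in
theorem IsNext.billiardMap_eq (h : T.IsNext z w) : T.billiardMap z = w :=
  (isNext_billiardMap ⟨w, h⟩).unique h

theorem measurableSet_domain : MeasurableSet T.domain :=
  measurableSet_setOf_exists_of_unique T.measurableSet_isNext fun _ _ _ => IsNext.unique

theorem measurable_billiardMap : Measurable T.billiardMap := by
  intro A hA
  have hpre : T.billiardMap ⁻¹' A =
      {z | ∃ w, (z, w) ∈ {p | T.IsNext p.1 p.2} ∩ Prod.snd ⁻¹' A} ∪ (T.domainᶜ ∩ A) := by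
    ext z
    by_cases h : z ∈ T.domain
    · have hw (w) : T.IsNext z w ↔ w = T.billiardMap z :=
        ⟨fun hw => hw.billiardMap_eq.symm, fun hw => hw ▸ isNext_billiardMap h⟩
      simp only [Set.mem_union, Set.mem_preimage, Set.mem_inter_iff, Set.mem_ofPred_eq, hw, h,
        Set.mem_compl_iff, not_true, false_and, or_false, exists_eq_left]
    · have hw (w) : ¬ T.IsNext z w := fun hw => h ⟨w, hw⟩
      simp [h, billiardMap_of_notMem h, hw]
  rw [hpre]
  exact (measurableSet_setOf_exists_of_unique
    (T.measurableSet_isNext.inter (measurable_snd hA))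
    fun _ _ _ h h' => IsNext.unique h.1 h'.1).union (T.measurableSet_domain.compl.inter hA)

end BilliardMap

end BilliardTable

theorem sin_toIcoMod_pi (x : ℝ) : Real.sin (toIcoMod Real.pi_pos 0 x) = |Real.sin x| := by
  have hmem := toIcoMod_mem_Ico' Real.pi_pos x
  rw [← abs_of_nonneg (Real.sin_nonneg_of_nonneg_of_le_pi hmem.1 hmem.2.le), toIcoMod,
    zsmul_eq_mul, Real.sin_sub_int_mul_pi, abs_mul, abs_zpow, abs_neg, abs_one, one_zpow, one_mul]

theorem toIcoMod_pi_eq_toIcoMod_of_sin_sub_eq_zero {x y : ℝ} (h : Real.sin (y - x) = 0) :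
    toIcoMod Real.pi_pos 0 x = toIcoMod Real.pi_pos 0 y := by
  obtain ⟨n, hn⟩ := Real.sin_eq_zero_iff.1 h
  exact (toIcoMod_eq_toIcoMod Real.pi_pos).2 ⟨n, by rw [zsmul_eq_mul, hn]⟩

theorem exists_rat_forall_abs_sub_le_of_hasStrictDerivAt {f : ℝ → ℝ} {d s : ℝ}
    (h : HasStrictDerivAt f d s) (hd : d ≠ 0) :
    ∃ (a b : ℚ) (n : ℕ), s ∈ Set.Icc (a : ℝ) b ∧
      ∀ t ∈ Set.Icc (a : ℝ) b, ∀ t' ∈ Set.Icc (a : ℝ) b, |t - t'| ≤ n * |f t - f t'| := by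
  obtain ⟨c, hc⟩ := (HasDerivAtFilter.isTheta_sub h hd).isBigO_symm.bound
  rw [nhds_prod_eq] at hc
  obtain ⟨u, hu, hcu⟩ := eventually_prod_self_iff
    (r := fun t t' => ‖t - t'‖ ≤ c * ‖f t - f t'‖).1 hc
  obtain ⟨l, r, hs, hlr⟩ := mem_nhds_iff_exists_Ioo_subset.1 hu
  obtain ⟨a, hla, has⟩ := exists_rat_btwn hs.1
  obtain ⟨b, hsb, hbr⟩ := exists_rat_btwn hs.2
  have hsub : Set.Icc (a : ℝ) b ⊆ u := fun t ht =>
    hlr ⟨hla.trans_le ht.1, ht.2.trans_lt hbr⟩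
  refine ⟨a, b, ⌈c⌉₊, ⟨has.le, hsb.le⟩, fun t ht t' ht' => ?_⟩
  exact (hcu t (hsub ht) t' (hsub ht')).trans
    (mul_le_mul_of_nonneg_right (Nat.le_ceil c) (norm_nonneg _))

/-- The signed distance from the origin of the line through a point in the direction `exp (iφ)`. -/
def offset (φ : ℝ) : ℂ →L[ℝ] ℝ := ω (Complex.exp (φ * Complex.I))

theorem offset_exp (φ ψ : ℝ) : offset φ (Complex.exp (ψ * Complex.I)) = Real.sin (ψ - φ) := by
  rw [offset, areaForm'_eq_im_conj_mul, ← Complex.exp_conj, ← Complex.exp_add, map_mul,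
    Complex.conj_ofReal, Complex.conj_I, ← Complex.exp_ofReal_mul_I_im]
  congr 2
  push_cast
  ring

theorem continuous_offset : Continuous fun p : ℝ × ℂ => offset p.1 p.2 := by
  simp only [offset, areaForm'_eq_im_conj_mul]
  fun_prop

theorem exists_offset_toIcoMod_eq_smul (x : ℝ) :
    ∃ c : ℝ, c ≠ 0 ∧ offset (toIcoMod Real.pi_pos 0 x) = c • ω (Complex.exp (x * Complex.I)) := by
  refine ⟨(-1) ^ (-toIcoDiv Real.pi_pos 0 x), zpow_ne_zero _ (by norm_num), ?_⟩
  have hexp : Complex.exp ((toIcoMod Real.pi_pos 0 x : ℝ) * Complex.I) =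
      ((-1 : ℝ) ^ (-toIcoDiv Real.pi_pos 0 x)) • Complex.exp (x * Complex.I) := by
    rw [toIcoMod, zsmul_eq_mul, Complex.real_smul, sub_eq_add_neg, add_comm]
    push_cast
    rw [add_mul, Complex.exp_add, ← neg_mul, mul_assoc, ← Int.cast_neg, Complex.exp_int_mul,
      Complex.exp_pi_mul_I]
  rw [offset, hexp, map_smul]

namespace BilliardTable

section Lines

variable {q : ℕ} (T : BilliardTable q)

theorem liouville_apply {E : Set (Fin q × ℝ × ℝ)} (hE : MeasurableSet E) :
    T.liouville E = ∑ α, ∫⁻ s in Set.Ico 0 (T.L α), ∫⁻ θ in Set.Ioo 0 Real.pi,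
      E.indicator (fun z => ENNReal.ofReal (Real.sin z.2.2)) (α, s, θ) := by
  have hsin : Measurable fun z : Fin q × ℝ × ℝ => ENNReal.ofReal (Real.sin z.2.2) := by fun_prop
  have hprod (α : Fin q) :
      Prod.mk α ⁻¹' T.phaseSpace = Set.Ico 0 (T.L α) ×ˢ Set.Ioo 0 Real.pi := rfl
  rw [liouville, withDensity_apply _ hE, ← lintegral_indicator hE,
    ← lintegral_indicator T.measurableSet_phaseSpace, lintegral_prod _
      ((hsin.indicator hE).indicator T.measurableSet_phaseSpace).aemeasurable, lintegral_count,
    tsum_fintype]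
  refine Finset.sum_congr rfl fun α _ => ?_
  have hE' : Measurable fun y => E.indicator (fun z => ENNReal.ofReal (Real.sin z.2.2)) (α, y) :=
    (hsin.indicator hE).comp measurable_prodMk_left
  rw [← setLIntegral_prod _ hE'.aemeasurable, ← lintegral_indicator
    (measurableSet_Ico.prod measurableSet_Ioo), ← hprod]
  rfl

theorem liouville_apply_of_forall_eq {α : Fin q} {E : Set (Fin q × ℝ × ℝ)} (hE : MeasurableSet E)
    (hα : ∀ z ∈ E, z.1 = α) :
    T.liouville E = ∫⁻ s in Set.Ico 0 (T.L α), ∫⁻ θ in Set.Ioo 0 Real.pi,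
      E.indicator (fun z => ENNReal.ofReal (Real.sin z.2.2)) (α, s, θ) := by
  rw [T.liouville_apply hE]
  refine Fintype.sum_eq_single α fun β hβ => ?_
  have hzero (s θ : ℝ) : E.indicator (fun z => ENNReal.ofReal (Real.sin z.2.2)) (β, s, θ) = 0 :=
    Set.indicator_of_notMem (fun h => hβ (hα _ h)) _
  simp only [hzero, lintegral_zero]

/-- The angle, modulo `π`, of the line that carries the ray of a phase point. -/
def lineAngle (z : Fin q × ℝ × ℝ) : ℝ :=
  toIcoMod Real.pi_pos 0 (z.2.2 + Complex.arg (T.tangent z))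

/-- The unoriented line that carries the ray of a phase point, given by its angle and its offset. -/
def line (z : Fin q × ℝ × ℝ) : ℝ × ℝ := (T.lineAngle z, offset (T.lineAngle z) (T.footpoint z))

/-- The phase point over the point `s` of the boundary component `α` whose ray lies on a line with
angle `φ`. -/
def rayPoint (α : Fin q) (φ s : ℝ) : Fin q × ℝ × ℝ :=
  (α, s, toIcoMod Real.pi_pos 0 (φ - Complex.arg (deriv (T.γ α) s)))

theorem measurable_lineAngle : Measurable T.lineAngle :=
  (measurable_toIcoMod_zero _).comp
    (measurable_snd.snd.add (Complex.measurable_arg.comp T.measurable_tangent))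

theorem measurable_line : Measurable T.line :=
  T.measurable_lineAngle.prodMk
    (continuous_offset.measurable.comp (T.measurable_lineAngle.prodMk T.measurable_footpoint) :)

theorem measurable_rayPoint (α : Fin q) :
    Measurable fun p : ℝ × ℝ => T.rayPoint α p.1 p.2 :=
  measurable_const.prodMk <| measurable_snd.prodMk <| (measurable_toIcoMod_zero _).comp <|
    measurable_fst.sub
      (Complex.measurable_arg.comp ((measurable_deriv (T.γ α)).comp measurable_snd))

theorem line_rayPoint {α : Fin q} {φ : ℝ} (hφ : φ ∈ Set.Ico 0 Real.pi) (s : ℝ) :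
    T.line (T.rayPoint α φ s) = (φ, offset φ (T.γ α s)) := by
  have hangle : T.lineAngle (T.rayPoint α φ s) = φ := by
    simp only [lineAngle, rayPoint, tangent]
    rw [toIcoMod_toIcoMod_add, sub_add_cancel, toIcoMod_eq_self, zero_add]
    exact hφ
  rw [line, hangle]
  rfl

variable {T} {z w : Fin q × ℝ × ℝ}

theorem rayPoint_lineAngle (hz : z ∈ T.phaseSpace) : T.rayPoint z.1 (T.lineAngle z) z.2.1 = z := by
  refine Prod.ext rfl (Prod.ext rfl ?_)
  simp only [rayPoint, lineAngle, tangent]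
  rw [toIcoMod_toIcoMod_sub, add_sub_cancel_right, toIcoMod_eq_self, zero_add]
  exact Set.Ioo_subset_Ico_self hz.2

theorem exp_arg_deriv_γ {α : Fin q} {s : ℝ} (h : ContDiffAt ℝ 1 (T.γ α) s) :
    Complex.exp (Complex.arg (deriv (T.γ α) s) * Complex.I) = deriv (T.γ α) s := by
  have hpolar := Complex.norm_mul_exp_arg_mul_I (deriv (T.γ α) s)
  rwa [T.unit_speed α s h, Complex.ofReal_one, one_mul] at hpolar

theorem sin_rayPoint {α : Fin q} {s : ℝ} (h : ContDiffAt ℝ 1 (T.γ α) s) (φ : ℝ) :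
    Real.sin (T.rayPoint α φ s).2.2 = |offset φ (deriv (T.γ α) s)| := by
  rw [rayPoint, sin_toIcoMod_pi]
  conv_rhs => rw [← exp_arg_deriv_γ h, offset_exp, ← abs_neg, ← Real.sin_neg, neg_sub]

theorem direction_eq_exp (h : T.IsRegular z) :
    T.direction z z.2.2 = Complex.exp ((z.2.2 + Complex.arg (T.tangent z) : ℝ) * Complex.I) := by
  rw [Complex.ofReal_add, add_mul, Complex.exp_add, tangent, exp_arg_deriv_γ h, direction]

theorem exists_offset_lineAngle_eq_smul (h : T.IsRegular z) :
    ∃ c : ℝ, c ≠ 0 ∧ offset (T.lineAngle z) = c • ω (T.direction z z.2.2) := by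
  rw [direction_eq_exp h]
  exact exists_offset_toIcoMod_eq_smul _

theorem offset_lineAngle_direction (h : T.IsRegular z) :
    offset (T.lineAngle z) (T.direction z z.2.2) = 0 := by
  obtain ⟨c, -, hc⟩ := exists_offset_lineAngle_eq_smul h
  rw [hc, smul_apply, areaForm'_self, smul_zero]

theorem lineAngle_eq_of_direction_eq_neg (hz : T.IsRegular z) (hw : T.IsRegular w)
    (h : T.direction w w.2.2 = -T.direction z z.2.2) : T.lineAngle w = T.lineAngle z := by
  refine toIcoMod_pi_eq_toIcoMod_of_sin_sub_eq_zero ?_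
  rw [← offset_exp, offset, ← direction_eq_exp hz, ← direction_eq_exp hw, h, map_neg,
    neg_apply, areaForm'_self, neg_zero]

theorem IsNext.line_reverse (h : T.IsNext z w) : T.line (reverse w) = T.line z := by
  obtain ⟨-, -, hzr, hwr, ⟨t, -, hfoot, -⟩, hdir⟩ := h
  have hangle : T.lineAngle (reverse w) = T.lineAngle z :=
    lineAngle_eq_of_direction_eq_neg hzr hwr (by rw [direction_reverse, ← hdir])
  have hoffset : offset (T.lineAngle z) (T.footpoint w) =
      offset (T.lineAngle z) (T.footpoint z) := by
    rw [hfoot, map_add, ← Complex.real_smul, map_smul, offset_lineAngle_direction hzr, smul_zero,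
      add_zero]
  rw [line, line, hangle]
  exact congrArg (Prod.mk _) hoffset

section LiouvilleAsArea

variable {α : Fin q} {E : Set (Fin q × ℝ × ℝ)}

theorem liouville_eq_lintegral_rayPoint (hE : MeasurableSet E) (hα : ∀ z ∈ E, z.1 = α) :
    T.liouville E = ∫⁻ φ in Set.Ico 0 Real.pi, ∫⁻ s in Set.Ico 0 (T.L α),
      E.indicator (fun z => ENNReal.ofReal (Real.sin z.2.2)) (T.rayPoint α φ s) := by
  have hsin : Measurable fun z : Fin q × ℝ × ℝ => ENNReal.ofReal (Real.sin z.2.2) := by fun_prop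
  refine (T.liouville_apply_of_forall_eq hE hα).trans (Eq.trans (lintegral_congr fun s => ?_)
    (lintegral_lintegral_swap (f := fun φ s => E.indicator
      (fun z => ENNReal.ofReal (Real.sin z.2.2)) (T.rayPoint α φ s))
      ((hsin.indicator hE).comp (T.measurable_rayPoint α)).aemeasurable).symm)
  rw [setLIntegral_congr Ioo_ae_eq_Ico]
  exact (setLIntegral_toIcoMod_sub Real.pi_pos (fun θ =>
    E.indicator (fun z => ENNReal.ofReal (Real.sin z.2.2)) (α, s, θ)) _).symm

theorem preimage_mk_image_line (hα : ∀ z ∈ E, z.1 = α) (hΦ : E ⊆ T.phaseSpace) {φ : ℝ}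
    (hφ : φ ∈ Set.Ico 0 Real.pi) :
    Prod.mk φ ⁻¹' (T.line '' E) = (fun s => offset φ (T.γ α s)) '' (T.rayPoint α φ ⁻¹' E) := by
  ext p
  constructor
  · rintro ⟨z, hz, hzp⟩
    obtain ⟨rfl : T.lineAngle z = φ, hp⟩ := Prod.ext_iff.1 hzp
    obtain rfl := hα z hz
    exact ⟨z.2.1, by rwa [Set.mem_preimage, rayPoint_lineAngle (hΦ hz)], hp⟩
  · rintro ⟨s, hs, rfl⟩
    exact ⟨_, hs, T.line_rayPoint hφ s⟩

theorem volume_preimage_mk_image_line (hE : MeasurableSet E) (hα : ∀ z ∈ E, z.1 = α)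
    (hΦ : E ⊆ T.phaseSpace) (hreg : ∀ z ∈ E, T.IsRegular z) (hinj : Set.InjOn T.line E) {φ : ℝ}
    (hφ : φ ∈ Set.Ico 0 Real.pi) :
    volume (Prod.mk φ ⁻¹' (T.line '' E)) = ∫⁻ s in Set.Ico 0 (T.L α),
      E.indicator (fun z => ENNReal.ofReal (Real.sin z.2.2)) (T.rayPoint α φ s) := by
  set S := T.rayPoint α φ ⁻¹' E
  have hSm : MeasurableSet S := (T.measurable_rayPoint α).comp measurable_prodMk_left hE
  have hSreg (s) (hs : s ∈ S) : ContDiffAt ℝ 1 (T.γ α) s := hreg _ hs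
  have hderiv : ∀ s ∈ S, HasDerivWithinAt (fun s => offset φ (T.γ α s))
      (offset φ (deriv (T.γ α) s)) S s := fun s hs =>
    ((offset φ).hasFDerivAt.comp_hasDerivAt s (hasDerivAt_γ (hSreg s hs))).hasDerivWithinAt
  have hSinj : Set.InjOn (fun s => offset φ (T.γ α s)) S := fun s hs t ht hst =>
    congrArg (fun z => z.2.1) <| hinj hs ht <| by
      rw [T.line_rayPoint hφ, T.line_rayPoint hφ]
      exact congrArg (Prod.mk φ) hst
  have hvol := lintegral_image_eq_lintegral_abs_deriv_mul hSm hderiv hSinj fun _ => 1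
  rw [setLIntegral_one] at hvol
  rw [preimage_mk_image_line hα hΦ hφ, hvol, ← lintegral_indicator measurableSet_Ico,
    ← lintegral_indicator hSm]
  refine lintegral_congr fun s => ?_
  by_cases hs : s ∈ S
  · rw [Set.indicator_of_mem hs, Set.indicator_of_mem (show s ∈ Set.Ico 0 (T.L α) from (hΦ hs).1),
      Set.indicator_of_mem (show T.rayPoint α φ s ∈ E from hs), mul_one,
      sin_rayPoint (hSreg s hs)]
  · rw [Set.indicator_of_notMem hs, eq_comm]
    exact Set.indicator_apply_eq_zero.2 fun _ =>
      Set.indicator_of_notMem (show T.rayPoint α φ s ∉ E from hs) _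

theorem volume_image_line (hE : MeasurableSet E) (hα : ∀ z ∈ E, z.1 = α) (hΦ : E ⊆ T.phaseSpace)
    (hreg : ∀ z ∈ E, T.IsRegular z) (hinj : Set.InjOn T.line E) :
    volume (T.line '' E) = T.liouville E := by
  rw [liouville_eq_lintegral_rayPoint hE hα, Measure.volume_eq_prod, Measure.prod_apply
    (hE.image_of_measurable_injOn T.measurable_line hinj), ← lintegral_indicator measurableSet_Ico]
  refine lintegral_congr fun φ => ?_
  by_cases hφ : φ ∈ Set.Ico 0 Real.pi
  · rw [Set.indicator_of_mem hφ, volume_preimage_mk_image_line hE hα hΦ hreg hinj hφ]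
  · rw [Set.indicator_of_notMem hφ]
    refine measure_mono_null ?_ (measure_empty (μ := volume))
    rintro p ⟨z, -, hz⟩
    obtain rfl : T.lineAngle z = φ := congrArg Prod.fst hz
    exact hφ (toIcoMod_mem_Ico' Real.pi_pos _)

end LiouvilleAsArea

end Lines

section InvarianceOfLiouville

variable {q : ℕ} (T : BilliardTable q)

/-- Phase points with footpoint on an arc of the boundary component `α` that meets every line
parallel to their ray at most once, so that the line determines the phase point.  The quantitative
form of this condition makes it measurable. -/
def piece (i : Fin q × ℚ × ℚ × ℕ) : Set (Fin q × ℝ × ℝ) :=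
  {z | z ∈ T.phaseSpace ∧ T.IsRegular z ∧ z.1 = i.1 ∧ z.2.1 ∈ Set.Icc (i.2.1 : ℝ) i.2.2.1 ∧
    ∀ t ∈ Set.Icc (i.2.1 : ℝ) i.2.2.1, ∀ t' ∈ Set.Icc (i.2.1 : ℝ) i.2.2.1,
      |t - t'| ≤ i.2.2.2 *
        |offset (T.lineAngle z) (T.γ i.1 t) - offset (T.lineAngle z) (T.γ i.1 t')|}

theorem measurableSet_piece (i : Fin q × ℚ × ℚ × ℕ) : MeasurableSet (T.piece i) := by
  have hoffset (x : ℂ) : Continuous fun φ => offset φ x :=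
    continuous_offset.comp (continuous_id.prodMk continuous_const)
  have hclosed : IsClosed {φ | ∀ t ∈ Set.Icc (i.2.1 : ℝ) i.2.2.1,
      ∀ t' ∈ Set.Icc (i.2.1 : ℝ) i.2.2.1,
      |t - t'| ≤ i.2.2.2 * |offset φ (T.γ i.1 t) - offset φ (T.γ i.1 t')|} := by
    simp only [Set.ofPred_forall]
    exact isClosed_iInter fun t => isClosed_iInter fun _ => isClosed_iInter fun t' =>
      isClosed_iInter fun _ => isClosed_le continuous_const
        (continuous_const.mul ((hoffset _).sub (hoffset _)).abs)
  exact T.measurableSet_phaseSpace.inter <| T.measurableSet_isRegular.inter <|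
    (measurable_fst (measurableSet_singleton i.1)).inter <|
    (measurable_snd.fst measurableSet_Icc).inter (T.measurable_lineAngle hclosed.measurableSet)

theorem injOn_line_piece (i : Fin q × ℚ × ℚ × ℕ) : Set.InjOn T.line (T.piece i) := by
  rintro z ⟨hz, -, hzi, hzs, hexpand⟩ w ⟨hw, -, hwi, hws, -⟩ h
  obtain ⟨hangle : T.lineAngle z = T.lineAngle w, hoffset⟩ := Prod.ext_iff.1 h
  have hs : z.2.1 = w.2.1 := by
    have hle := hexpand _ hzs _ hws
    rw [show offset (T.lineAngle z) (T.γ i.1 z.2.1) = offset (T.lineAngle z) (T.γ i.1 w.2.1) by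
      simpa only [line, footpoint, hzi, hwi, ← hangle] using hoffset, sub_self, abs_zero,
      mul_zero] at hle
    exact sub_eq_zero.1 (abs_nonpos_iff.1 hle)
  rw [← rayPoint_lineAngle hz, ← rayPoint_lineAngle hw, hangle, hs, hzi, hwi]

theorem volume_image_line_of_subset_piece (i : Fin q × ℚ × ℚ × ℕ) (E : Set (Fin q × ℝ × ℝ))
    (hEi : E ⊆ T.piece i) (hE : MeasurableSet E) : volume (T.line '' E) = T.liouville E :=
  volume_image_line hE (fun _ hz => (hEi hz).2.2.1) (fun _ hz => (hEi hz).1)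
    (fun _ hz => (hEi hz).2.1) ((T.injOn_line_piece i).mono hEi)

theorem offset_lineAngle_tangent_ne_zero {z : Fin q × ℝ × ℝ} (hz : z ∈ T.phaseSpace)
    (h : T.IsRegular z) : offset (T.lineAngle z) (T.tangent z) ≠ 0 := by
  rw [← abs_pos, tangent, ← sin_rayPoint h, rayPoint_lineAngle hz]
  exact Real.sin_pos_of_mem_Ioo hz.2

theorem mem_iUnion_piece {z : Fin q × ℝ × ℝ} (hz : z ∈ T.phaseSpace) (h : T.IsRegular z) :
    z ∈ ⋃ i, T.piece i := by
  have hstrict : HasStrictDerivAt (fun s => offset (T.lineAngle z) (T.γ z.1 s))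
      (offset (T.lineAngle z) (T.tangent z)) z.2.1 :=
    (offset (T.lineAngle z)).hasStrictFDerivAt.comp_hasStrictDerivAt z.2.1
      (h.hasStrictDerivAt one_ne_zero)
  obtain ⟨a, b, n, hs, hexpand⟩ := exists_rat_forall_abs_sub_le_of_hasStrictDerivAt hstrict
    (T.offset_lineAngle_tangent_ne_zero hz h)
  exact Set.mem_iUnion.2 ⟨(z.1, a, b, n), hz, h, rfl, hs, hexpand⟩

/-- The lines that run into a corner of the boundary or are tangent to it. -/
def singularLines : Set (ℝ × ℝ) :=
  {p | ∃ (β : Fin q) (s : ℝ), s ∈ Set.Ico 0 (T.L β) ∧ offset p.1 (T.γ β s) = p.2 ∧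
    (ContDiffAt ℝ 1 (T.γ β) s → offset p.1 (deriv (T.γ β) s) = 0)}

theorem volume_preimage_mk_singularLines (φ : ℝ) :
    volume (Prod.mk φ ⁻¹' T.singularLines) = 0 := by
  have hcorners (β : Fin q) : volume ((fun s => offset φ (T.γ β s)) ''
      {s ∈ Set.Ico 0 (T.L β) | ¬ ContDiffAt ℝ 1 (T.γ β) s}) = 0 :=
    ((T.finite_corners β).image _).measure_zero _
  have htangencies (β : Fin q) : volume ((fun s => offset φ (T.γ β s)) ''
      {s | ContDiffAt ℝ 1 (T.γ β) s ∧ offset φ (deriv (T.γ β) s) = 0}) = 0 :=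
    addHaar_image_eq_zero_of_det_fderivWithin_eq_zero volume
      (fun s hs => ((offset φ).hasFDerivAt.comp_hasDerivAt s
        (hasDerivAt_γ hs.1)).hasFDerivAt.hasFDerivWithinAt)
      fun s hs => by rw [hs.2, ContinuousLinearMap.det_toSpanSingleton]
  refine measure_mono_null ?_ (measure_iUnion_null fun β =>
    measure_union_null (hcorners β) (htangencies β))
  rintro p ⟨β, s, hs, hp, hsing⟩
  by_cases hreg : ContDiffAt ℝ 1 (T.γ β) s
  · exact Set.mem_iUnion.2 ⟨β, Or.inr ⟨s, ⟨hreg, hsing hreg⟩, hp⟩⟩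
  · exact Set.mem_iUnion.2 ⟨β, Or.inl ⟨s, ⟨hs, hreg⟩, hp⟩⟩

theorem line_mem_singularLines {z : Fin q × ℝ × ℝ} (hz : z ∈ T.phaseSpace) (h : T.IsRegular z)
    (hd : z ∉ T.domain) : T.line z ∈ T.singularLines := by
  obtain ⟨β, s, t, hs, hst, hsing⟩ := (exists_isNext_or_exists_singular hz h).resolve_left hd
  refine ⟨β, s, hs, ?_, fun hreg => ?_⟩
  · rw [hst, map_add, map_smul]
    exact (congrArg _ ((congrArg _ (offset_lineAngle_direction h)).trans (smul_zero t))).trans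
      (add_zero _)
  · obtain ⟨c, -, hc⟩ := exists_offset_lineAngle_eq_smul h
    change offset (T.lineAngle z) _ = 0
    rw [hc, smul_apply, areaForm'_swap, hsing hreg, neg_zero, smul_zero]

theorem ae_mem_phaseSpace : ∀ᵐ z ∂T.liouville, z ∈ T.phaseSpace :=
  (withDensity_absolutelyContinuous _ _).ae_le (ae_restrict_mem T.measurableSet_phaseSpace)

theorem ae_isRegular : ∀ᵐ z ∂T.liouville, T.IsRegular z := by
  change T.liouville {z | T.IsRegular z}ᶜ = 0
  rw [T.liouville_apply T.measurableSet_isRegular.compl]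
  refine Finset.sum_eq_zero fun α _ => lintegral_eq_zero_of_ae_eq_zero ?_
  have hcorners := measure_eq_zero_iff_ae_notMem.1 ((T.finite_corners α).measure_zero volume)
  filter_upwards [ae_restrict_of_ae hcorners, ae_restrict_mem measurableSet_Ico] with s hs hs'
  have hreg : ContDiffAt ℝ 1 (T.γ α) s := by_contra fun h => hs ⟨hs', h⟩
  have hzero (θ : ℝ) : {z | T.IsRegular z}ᶜ.indicator
      (fun z => ENNReal.ofReal (Real.sin z.2.2)) (α, s, θ) = 0 :=
    Set.indicator_of_notMem (not_not.2 hreg) _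
  simp only [hzero, lintegral_zero, Pi.zero_apply]

theorem liouville_piece_diff_domain (i : Fin q × ℚ × ℚ × ℕ) :
    T.liouville (T.piece i \ T.domain) = 0 := by
  have hmeas : MeasurableSet (T.piece i \ T.domain) :=
    (T.measurableSet_piece i).diff T.measurableSet_domain
  rw [← T.volume_image_line_of_subset_piece i _ Set.sdiff_subset hmeas]
  refine (Measure.measure_prod_null (hmeas.image_of_measurable_injOn T.measurable_line
    ((T.injOn_line_piece i).mono Set.sdiff_subset))).2 (.of_forall fun φ =>
      measure_mono_null (Set.preimage_mono ?_) (T.volume_preimage_mk_singularLines φ))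
  rintro _ ⟨z, ⟨hz, hd⟩, rfl⟩
  exact T.line_mem_singularLines hz.1 hz.2.1 hd

theorem ae_mem_domain : ∀ᵐ z ∂T.liouville, z ∈ T.domain := by
  have hnull := measure_eq_zero_iff_ae_notMem.1
    (measure_iUnion_null fun i => T.liouville_piece_diff_domain i)
  filter_upwards [hnull, T.ae_mem_phaseSpace, T.ae_isRegular] with z hz hΦ hreg
  obtain ⟨i, hi⟩ := Set.mem_iUnion.1 (T.mem_iUnion_piece hΦ hreg)
  exact by_contra fun hd => hz (Set.mem_iUnion.2 ⟨i, hi, hd⟩)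

theorem measurePreserving_reverse :
    MeasurePreserving BilliardTable.reverse T.liouville T.liouville := by
  refine ⟨measurable_reverse, Measure.ext fun E hE => ?_⟩
  rw [Measure.map_apply measurable_reverse hE, T.liouville_apply hE,
    T.liouville_apply (measurable_reverse hE)]
  refine Finset.sum_congr rfl fun α _ => lintegral_congr fun s => ?_
  rw [← setLIntegral_Ioo_sub_left Real.pi (fun θ => E.indicator _ (α, s, θ))]
  refine lintegral_congr fun θ => ?_
  by_cases h : (α, s, Real.pi - θ) ∈ E
  · rw [Set.indicator_of_mem h, Set.indicator_of_mem (show (α, s, θ) ∈ reverse ⁻¹' E from h),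
      Real.sin_pi_sub]
  · rw [Set.indicator_of_notMem h,
      Set.indicator_of_notMem (show (α, s, θ) ∉ reverse ⁻¹' E from h)]

/-- The phase point at the end of the ray of `z` that looks back along this ray. -/
def lookBack (z : Fin q × ℝ × ℝ) : Fin q × ℝ × ℝ := reverse (T.billiardMap z)

theorem reverse_lookBack (z : Fin q × ℝ × ℝ) : reverse (T.lookBack z) = T.billiardMap z :=
  reverse_reverse _

theorem isNext_lookBack {z : Fin q × ℝ × ℝ} (hz : z ∈ T.domain) :
    T.IsNext (T.lookBack z) (reverse z) :=
  isNext_reverse (isNext_billiardMap hz)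

theorem billiardMap_lookBack {z : Fin q × ℝ × ℝ} (hz : z ∈ T.domain) :
    T.billiardMap (T.lookBack z) = reverse z :=
  (T.isNext_lookBack hz).billiardMap_eq

theorem lookBack_lookBack {z : Fin q × ℝ × ℝ} (hz : z ∈ T.domain) :
    T.lookBack (T.lookBack z) = z := by
  rw [lookBack, T.billiardMap_lookBack hz, reverse_reverse]

theorem measurePreserving_lookBack : MeasurePreserving T.lookBack T.liouville T.liouville := by
  rw [← Measure.restrict_eq_self_of_ae_mem T.ae_mem_domain]
  exact measurePreserving_restrict_of_involution T.measurableSet_piece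
    T.volume_image_line_of_subset_piece T.measurableSet_domain
    (fun z ⟨_, h⟩ => T.mem_iUnion_piece h.1 h.2.2.1)
    (measurable_reverse.comp T.measurable_billiardMap)
    (fun z hz => ⟨_, T.isNext_lookBack hz⟩) (fun z hz => T.lookBack_lookBack hz)
    fun z hz => (isNext_billiardMap hz).line_reverse

theorem measurePreserving_billiardMap :
    MeasurePreserving T.billiardMap T.liouville T.liouville := by
  rw [← funext T.reverse_lookBack]
  exact T.measurePreserving_reverse.comp T.measurePreserving_lookBack

end InvarianceOfLiouville

section Gain

theorem increment_self (L s : ℝ) : increment L s s = 0 := by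
  rw [increment, if_pos le_rfl, sub_self]

theorem increment_mem_Icc {L s t : ℝ} (hs : s ∈ Set.Ico 0 L) (ht : t ∈ Set.Ico 0 L) :
    increment L s t ∈ Set.Icc 0 L := by
  unfold increment
  split_ifs <;> constructor <;> linarith [hs.1, hs.2, ht.1, ht.2]

theorem increment_add_increment {L s t : ℝ} (h : s ≠ t) :
    increment L s t + increment L t s = L := by
  unfold increment
  rcases lt_or_gt_of_ne h with h | h
  · rw [if_pos h.le, if_neg (not_le.2 h)]
    ring
  · rw [if_neg (not_le.2 h), if_pos h.le]
    ring

theorem measurable_increment (L : ℝ) : Measurable fun p : ℝ × ℝ => increment L p.1 p.2 :=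
  Measurable.ite (measurableSet_le measurable_fst measurable_snd) (by fun_prop) (by fun_prop)

variable {q : ℕ} (T : BilliardTable q) {α : Fin q} {z : Fin q × ℝ × ℝ} {k l m n N : ℕ}

theorem billiardMap_mem_phaseSpace (hz : z ∈ T.phaseSpace) : T.billiardMap z ∈ T.phaseSpace := by
  by_cases h : z ∈ T.domain
  · exact (isNext_billiardMap h).2.1
  · rwa [billiardMap_of_notMem h]

theorem billiardMap_of_notMem_phaseSpace (hz : z ∉ T.phaseSpace) : T.billiardMap z = z :=
  billiardMap_of_notMem fun ⟨_, h⟩ => hz h.1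

variable {T} in
theorem Visits.coord_mem_Ico (h : T.Visits α z k) (hz : z ∈ T.phaseSpace) :
    (T.billiardMap^[k] z).2.1 ∈ Set.Ico 0 (T.L α) := by
  have hmaps : Set.MapsTo T.billiardMap T.phaseSpace T.phaseSpace :=
    fun _ => T.billiardMap_mem_phaseSpace
  exact h ▸ (hmaps.iterate k hz).1

theorem visits_iterate : T.Visits α (T.billiardMap^[k] z) n ↔ T.Visits α z (k + n) := by
  rw [Visits, Visits, add_comm k, Function.iterate_add_apply]

theorem consecutiveVisits_iterate :
    T.ConsecutiveVisits α (T.billiardMap^[k] z) 0 n ↔ T.ConsecutiveVisits α z k (k + n) := by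
  simp only [ConsecutiveVisits, visits_iterate, add_zero]
  refine and_congr (by omega) (and_congr_right' (and_congr_right' ⟨fun h j hkj hjn => ?_,
    fun h j _ _ => h (k + j) (by omega) (by omega)⟩))
  have hj := h (j - k) (by omega) (by omega)
  rwa [Nat.add_sub_cancel' hkj.le] at hj

variable {T} in
theorem ConsecutiveVisits.unique (h : T.ConsecutiveVisits α z k l)
    (h' : T.ConsecutiveVisits α z k m) : l = m := by
  rcases lt_trichotomy l m with hlt | heq | hlt
  · exact absurd h.2.2.1 (h'.2.2.2 l h.1 hlt)
  · exact heq
  · exact absurd h'.2.2.1 (h.2.2.2 m h'.1 hlt)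

theorem measurableSet_visits (α : Fin q) (k : ℕ) : MeasurableSet {z | T.Visits α z k} :=
  (measurable_fst.comp (T.measurable_billiardMap.iterate k)) (measurableSet_singleton α)

theorem measurableSet_consecutiveVisits (α : Fin q) (k l : ℕ) :
    MeasurableSet {z | T.ConsecutiveVisits α z k l} := by
  refine (MeasurableSet.const _).inter ((T.measurableSet_visits α k).inter
    ((T.measurableSet_visits α l).inter ?_))
  change MeasurableSet {z | ∀ j, k < j → j < l → ¬ T.Visits α z j}
  simp only [Set.ofPred_forall]
  exact .iInter fun j => .iInter fun _ => .iInter fun _ => (T.measurableSet_visits α j).compl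

/-- The time of the next visit to `α` of a point on `α`.  It is `0` if there is no such visit, or
if the point does not lie on `α`. -/
def returnTime (α : Fin q) (z : Fin q × ℝ × ℝ) : ℕ := sInf {n | T.ConsecutiveVisits α z 0 n}

theorem consecutiveVisits_zero_iff :
    T.ConsecutiveVisits α z 0 n ↔ n ≠ 0 ∧ T.returnTime α z = n := by
  constructor
  · intro h
    exact ⟨h.1.ne', (Nat.sInf_mem (s := {n | T.ConsecutiveVisits α z 0 n}) ⟨n, h⟩).unique h⟩
  · rintro ⟨hn, rfl⟩
    exact Nat.sInf_mem (Nat.nonempty_of_pos_sInf (Nat.pos_of_ne_zero hn))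

theorem consecutiveVisits_iff : T.ConsecutiveVisits α z k l ↔
    k < l ∧ k + T.returnTime α (T.billiardMap^[k] z) = l := by
  constructor
  · intro h
    obtain ⟨n, rfl⟩ := Nat.exists_eq_add_of_lt h.1
    have hn := T.consecutiveVisits_iterate.2 (show T.ConsecutiveVisits α z k (k + (n + 1)) from h)
    exact ⟨h.1, by rw [(T.consecutiveVisits_zero_iff.1 hn).2, add_assoc]⟩
  · rintro ⟨hkl, rfl⟩
    exact T.consecutiveVisits_iterate.1 (T.consecutiveVisits_zero_iff.2 ⟨by omega, rfl⟩)

theorem measurable_returnTime (α : Fin q) : Measurable (T.returnTime α) := by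
  have hpos (n : ℕ) (hn : n ≠ 0) : MeasurableSet (T.returnTime α ⁻¹' {n}) := by
    convert! T.measurableSet_consecutiveVisits α 0 n using 1
    ext z
    simp [consecutiveVisits_zero_iff, hn]
  refine measurable_to_countable' fun n => ?_
  obtain rfl | hn := eq_or_ne n 0
  · have hzero : T.returnTime α ⁻¹' {0} = (⋃ n : ℕ, ⋃ _ : n ≠ 0, T.returnTime α ⁻¹' {n})ᶜ := by
      ext z
      simp only [Set.mem_preimage, Set.mem_singleton_iff, Set.mem_compl_iff, Set.mem_iUnion,
        not_exists]
      exact ⟨fun h n hn hr => hn (hr.symm.trans h), fun h => not_not.1 fun hr => h _ hr rfl⟩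
    rw [hzero]
    exact (MeasurableSet.iUnion fun n => .iUnion (hpos n)).compl
  · exact hpos n hn

/-- The increment of the arclength coordinate between a visit to `α` and the next one. -/
def gain (α : Fin q) (z : Fin q × ℝ × ℝ) : ℝ :=
  increment (T.L α) z.2.1 (T.billiardMap^[T.returnTime α z] z).2.1

theorem gain_eq_zero (h : T.returnTime α z = 0) : T.gain α z = 0 := by
  rw [gain, h, Function.iterate_zero_apply, increment_self]

theorem gain_mem_Icc (α : Fin q) (z : Fin q × ℝ × ℝ) : T.gain α z ∈ Set.Icc 0 (T.L α) := by
  by_cases hz : z ∈ T.phaseSpace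
  · obtain h | h := eq_or_ne (T.returnTime α z) 0
    · rw [T.gain_eq_zero h]
      exact Set.left_mem_Icc.2 (T.L_pos α).le
    · obtain ⟨-, hk, hl, -⟩ := T.consecutiveVisits_zero_iff.2 ⟨h, rfl⟩
      exact increment_mem_Icc (hk.coord_mem_Ico hz) (hl.coord_mem_Ico hz)
  · rw [gain, Function.iterate_fixed (T.billiardMap_of_notMem_phaseSpace hz), increment_self]
    exact Set.left_mem_Icc.2 (T.L_pos α).le

theorem abs_gain_le (α : Fin q) (z : Fin q × ℝ × ℝ) : |T.gain α z| ≤ T.L α := by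
  rw [abs_of_nonneg (T.gain_mem_Icc α z).1]
  exact (T.gain_mem_Icc α z).2

theorem measurable_gain (α : Fin q) : Measurable (T.gain α) := by
  have hiterate : Measurable fun p : ℕ × Fin q × ℝ × ℝ => T.billiardMap^[p.1] p.2 :=
    measurable_from_prod_countable_right fun n => T.measurable_billiardMap.iterate n
  exact (measurable_increment (T.L α)).comp (measurable_snd.fst.prodMk
    (hiterate.comp ((T.measurable_returnTime α).prodMk measurable_id)).snd.fst)

theorem ConsecutiveVisits.gain_eq (h : T.ConsecutiveVisits α z k l) :
    T.gain α (T.billiardMap^[k] z) =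
      increment (T.L α) (T.billiardMap^[k] z).2.1 (T.billiardMap^[l] z).2.1 := by
  rw [gain, ← Function.iterate_add_apply, add_comm, (T.consecutiveVisits_iff.1 h).2]

open Classical in
theorem sum_ite_consecutiveVisits :
    (∑ l ∈ Finset.range (N + 1), if T.ConsecutiveVisits α z k l then
      increment (T.L α) (T.billiardMap^[k] z).2.1 (T.billiardMap^[l] z).2.1 else 0) =
    if k + T.returnTime α (T.billiardMap^[k] z) ≤ N then T.gain α (T.billiardMap^[k] z) else 0 := by
  set r := T.returnTime α (T.billiardMap^[k] z)
  obtain h | h := eq_or_ne r 0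
  · rw [T.gain_eq_zero h, ite_self]
    exact Finset.sum_eq_zero fun l _ => if_neg fun hl => by
      have := T.consecutiveVisits_iff.1 hl
      omega
  · have hnext : T.ConsecutiveVisits α z k (k + r) := T.consecutiveVisits_iff.2 ⟨by omega, rfl⟩
    have hiff (l : ℕ) : T.ConsecutiveVisits α z k l ↔ k + r = l :=
      ⟨fun hl => (T.consecutiveVisits_iff.1 hl).2, fun hl => hl ▸ hnext⟩
    simp only [hiff, Finset.sum_ite_eq, Finset.mem_range, Nat.lt_succ_iff, hnext.gain_eq]

theorem card_filter_lt_add_returnTime_le_one (α : Fin q) (z : Fin q × ℝ × ℝ) (N : ℕ) :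
    (Finset.range (N + 1) |>.filter
      fun k => N < k + T.returnTime α (T.billiardMap^[k] z)).card ≤ 1 := by
  have hlast {k l : ℕ} (hl : l ≤ N) (hN : N < k + T.returnTime α (T.billiardMap^[k] z))
      (hN' : N < l + T.returnTime α (T.billiardMap^[l] z)) : l ≤ k := by
    by_contra! hkl
    have hk := T.consecutiveVisits_iff.2 ⟨hkl.trans (hl.trans_lt hN), rfl⟩
    have hl' := T.consecutiveVisits_iff.2 ⟨hl.trans_lt hN', rfl⟩
    exact hk.2.2.2 l hkl (hl.trans_lt hN) hl'.2.1
  refine Finset.card_le_one.2 fun k hk l hl => ?_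
  simp only [Finset.mem_filter, Finset.mem_range, Nat.lt_succ_iff] at hk hl
  exact le_antisymm (hlast hk.1 hl.2 hk.2) (hlast hl.1 hk.2 hl.2)

theorem abs_totalIncrement_sub_birkhoffSum_le (α : Fin q) (z : Fin q × ℝ × ℝ) (N : ℕ) :
    |T.totalIncrement α z N - birkhoffSum T.billiardMap (T.gain α) N z| ≤ T.L α := by
  set g : ℕ → ℝ := fun k => T.gain α (T.billiardMap^[k] z)
  set pending := Finset.range (N + 1) |>.filter
    fun k => N < k + T.returnTime α (T.billiardMap^[k] z) with hpending
  have hsplit : T.totalIncrement α z N + ∑ k ∈ pending, g k =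
      birkhoffSum T.billiardMap (T.gain α) N z + g N := by
    simp only [totalIncrement, sum_ite_consecutiveVisits]
    rw [← birkhoffSum_succ, birkhoffSum, ← Finset.sum_filter, hpending]
    simp only [← not_le]
    exact Finset.sum_filter_add_sum_filter_not _ _ _
  have hnonneg : 0 ≤ ∑ k ∈ pending, g k := Finset.sum_nonneg fun k _ => (T.gain_mem_Icc α _).1
  have hle : ∑ k ∈ pending, g k ≤ T.L α :=
    calc ∑ k ∈ pending, g k ≤ pending.card • T.L α :=
          Finset.sum_le_card_nsmul _ _ _ fun k _ => (T.gain_mem_Icc α _).2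
      _ ≤ 1 • T.L α := nsmul_le_nsmul_left (T.L_pos α).le
          (T.card_filter_lt_add_returnTime_le_one α z N)
      _ = T.L α := one_nsmul _
  have hgN : g N ∈ Set.Icc 0 (T.L α) := T.gain_mem_Icc α _
  rw [abs_le]
  constructor <;> linarith [hgN.1, hgN.2]

theorem hasFootpointGain_of_tendsto_birkhoffAverage {u : ℝ}
    (h : Tendsto (fun n => birkhoffAverage ℝ T.billiardMap (T.gain α) n z) atTop (𝓝 u)) :
    T.HasFootpointGain α z u := by
  have hdiff : Tendsto (fun N : ℕ => (T.totalIncrement α z N -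
      birkhoffSum T.billiardMap (T.gain α) N z) / N) atTop (𝓝 0) := by
    refine squeeze_zero_norm (fun N => ?_) (tendsto_const_div_atTop_nhds_zero_nat (T.L α))
    rw [norm_div, Real.norm_natCast, Real.norm_eq_abs]
    gcongr
    exact T.abs_totalIncrement_sub_birkhoffSum_le α z N
  have hsum := h.add hdiff
  rw [add_zero] at hsum
  refine hsum.congr fun N => ?_
  rw [birkhoffAverage, smul_eq_mul]
  ring

end Gain

section MeanGain

variable {q : ℕ} (T : BilliardTable q) {α : Fin q} {z : Fin q × ℝ × ℝ} {k n : ℕ}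

theorem setLIntegral_ofReal_sin :
    ∫⁻ θ in Set.Ioo 0 Real.pi, ENNReal.ofReal (Real.sin θ) = 2 := by
  rw [setLIntegral_congr Ioo_ae_eq_Ioc, ← ofReal_integral_eq_lintegral_ofReal,
    ← intervalIntegral.integral_of_le Real.pi_pos.le, integral_sin, Real.cos_zero, Real.cos_pi]
  · norm_num
  · exact Real.continuous_sin.integrableOn_Ioc
  · filter_upwards [ae_restrict_mem measurableSet_Ioc] with θ hθ
    exact Real.sin_nonneg_of_nonneg_of_le_pi hθ.1.le hθ.2

theorem measurableSet_preimage_fst (α : Fin q) :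
    MeasurableSet (Prod.fst ⁻¹' {α} : Set (Fin q × ℝ × ℝ)) :=
  measurable_fst (measurableSet_singleton α)

theorem liouville_preimage_fst (α : Fin q) :
    T.liouville (Prod.fst ⁻¹' {α}) = ENNReal.ofReal (2 * T.L α) := by
  have hindicator (s θ : ℝ) : (Prod.fst ⁻¹' {α} : Set (Fin q × ℝ × ℝ)).indicator
      (fun z => ENNReal.ofReal (Real.sin z.2.2)) (α, s, θ) = ENNReal.ofReal (Real.sin θ) :=
    Set.indicator_of_mem (s := Prod.fst ⁻¹' {α}) rfl _
  rw [T.liouville_apply_of_forall_eq (measurableSet_preimage_fst α) fun _ hz => hz]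
  simp only [hindicator, setLIntegral_ofReal_sin]
  rw [setLIntegral_const, Real.volume_Ico, sub_zero, ENNReal.ofReal_mul zero_le_two,
    ENNReal.ofReal_ofNat]

theorem liouville_univ : T.liouville Set.univ = ENNReal.ofReal (2 * T.perimeter) := by
  rw [← Set.preimage_univ (f := Prod.fst), ← Finset.coe_univ,
    ← sum_measure_preimage_singleton _ fun α _ => measurableSet_preimage_fst α, perimeter,
    Finset.mul_sum, ENNReal.ofReal_sum_of_nonneg fun α _ => by linarith [T.L_pos α]]
  exact Finset.sum_congr rfl fun α _ => T.liouville_preimage_fst α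

instance isFiniteMeasure_liouville : IsFiniteMeasure T.liouville :=
  ⟨by rw [T.liouville_univ]; exact ENNReal.ofReal_lt_top⟩

theorem perimeter_pos (α : Fin q) : 0 < T.perimeter :=
  Finset.sum_pos (fun β _ => T.L_pos β) ⟨α, Finset.mem_univ α⟩

theorem liouville_real_univ : T.liouville.real Set.univ = 2 * T.perimeter := by
  have hnonneg : 0 ≤ T.perimeter := Finset.sum_nonneg fun α _ => (T.L_pos α).le
  rw [Measure.real, T.liouville_univ, ENNReal.toReal_ofReal (by positivity)]

theorem liouville_real_preimage_fst (α : Fin q) :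
    T.liouville.real (Prod.fst ⁻¹' {α}) = 2 * T.L α := by
  rw [Measure.real, T.liouville_preimage_fst, ENNReal.toReal_ofReal (by linarith [T.L_pos α])]

theorem ae_forall_iterate_mem_domain :
    ∀ᵐ z ∂T.liouville, ∀ k, T.billiardMap^[k] z ∈ T.domain :=
  ae_all_iff.2 fun k =>
    (T.measurePreserving_billiardMap.iterate k).quasiMeasurePreserving.ae T.ae_mem_domain

theorem iterate_reverse_iterate (h : ∀ k < n, T.billiardMap^[k] z ∈ T.domain) :
    T.billiardMap^[n] (reverse (T.billiardMap^[n] z)) = reverse z := by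
  induction n with
  | zero => rfl
  | succ n ih =>
    rw [Function.iterate_succ_apply' _ n z, Function.iterate_succ_apply, ← lookBack,
      T.billiardMap_lookBack (h n n.lt_succ_self)]
    exact ih fun k hk => h k (hk.trans n.lt_succ_self)

theorem iterate_reverse_iterate_of_le (hkn : k ≤ n) (h : ∀ k, T.billiardMap^[k] z ∈ T.domain) :
    T.billiardMap^[k] (reverse (T.billiardMap^[n] z)) = reverse (T.billiardMap^[n - k] z) := by
  have hreverse := T.iterate_reverse_iterate (z := T.billiardMap^[n - k] z) (n := k) fun j _ => by
    rw [← Function.iterate_add_apply]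
    exact h _
  rwa [← Function.iterate_add_apply, Nat.add_sub_cancel' hkn] at hreverse

/-- The phase points on `α` whose orbit returns to `α` for the first time at time `n`, and at
another footpoint. -/
def openReturns (α : Fin q) (n : ℕ) : Set (Fin q × ℝ × ℝ) :=
  {z | T.ConsecutiveVisits α z 0 n ∧ z.2.1 ≠ (T.billiardMap^[n] z).2.1}

theorem measurableSet_openReturns (α : Fin q) (n : ℕ) : MeasurableSet (T.openReturns α n) :=
  (T.measurableSet_consecutiveVisits α 0 n).inter
    (measurableSet_eq_fun measurable_snd.fst (T.measurable_billiardMap.iterate n).snd.fst).compl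

variable {T} in
theorem gain_of_mem_openReturns (hz : z ∈ T.openReturns α n) :
    T.gain α z = increment (T.L α) z.2.1 (T.billiardMap^[n] z).2.1 :=
  ConsecutiveVisits.gain_eq T hz.1

theorem reverse_iterate_mem_openReturns (h : ∀ k, T.billiardMap^[k] z ∈ T.domain)
    (hz : z ∈ T.openReturns α n) : reverse (T.billiardMap^[n] z) ∈ T.openReturns α n := by
  obtain ⟨⟨hn, hvisit, hreturn, hbetween⟩, hne⟩ := hz
  have hvisits (k : ℕ) (hk : k ≤ n) : T.Visits α (reverse (T.billiardMap^[n] z)) k ↔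
      T.Visits α z (n - k) := by
    rw [Visits, T.iterate_reverse_iterate_of_le hk h]
    rfl
  refine ⟨⟨hn, (hvisits 0 hn.le).2 hreturn, (hvisits n le_rfl).2 (by rwa [Nat.sub_self]),
    fun j hj hjn => ?_⟩, ?_⟩
  · rw [hvisits j hjn.le]
    exact hbetween _ (by omega) (by omega)
  · rw [T.iterate_reverse_iterate fun k _ => h k]
    exact hne.symm

theorem measurePreserving_reverse_iterate (n : ℕ) :
    MeasurePreserving (fun z => reverse (T.billiardMap^[n] z)) T.liouville T.liouville :=
  T.measurePreserving_reverse.comp (T.measurePreserving_billiardMap.iterate n)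

theorem preimage_openReturns_ae_eq (α : Fin q) (n : ℕ) :
    (fun z => reverse (T.billiardMap^[n] z)) ⁻¹' T.openReturns α n =ᵐ[T.liouville]
      T.openReturns α n := by
  filter_upwards [T.ae_forall_iterate_mem_domain,
    (T.measurePreserving_reverse_iterate n).quasiMeasurePreserving.ae
      T.ae_forall_iterate_mem_domain] with z hz hKz
  refine propext ⟨fun h => ?_, T.reverse_iterate_mem_openReturns hz⟩
  have hKKz := T.reverse_iterate_mem_openReturns hKz h
  rwa [T.iterate_reverse_iterate fun k _ => hz k, reverse_reverse] at hKKz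

theorem integrable_gain (α : Fin q) : Integrable (T.gain α) T.liouville :=
  .of_bound (T.measurable_gain α).aestronglyMeasurable (T.L α) (.of_forall (T.abs_gain_le α))

theorem setIntegral_openReturns_gain (α : Fin q) (n : ℕ) :
    ∫ z in T.openReturns α n, T.gain α z ∂T.liouville =
      T.L α / 2 * T.liouville.real (T.openReturns α n) := by
  refine setIntegral_eq_of_add_comp_eq (T.measurePreserving_reverse_iterate n)
    (T.measurableSet_openReturns α n) (T.preimage_openReturns_ae_eq α n)
    (T.integrable_gain α).integrableOn ?_
  filter_upwards [ae_restrict_of_ae T.ae_forall_iterate_mem_domain,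
    ae_restrict_mem (T.measurableSet_openReturns α n)] with z hz hzn
  rw [gain_of_mem_openReturns hzn,
    gain_of_mem_openReturns (T.reverse_iterate_mem_openReturns hz hzn),
    T.iterate_reverse_iterate fun k _ => hz k]
  exact increment_add_increment hzn.2

theorem measurableSet_closedReturns (α : Fin q) : MeasurableSet (T.closedReturns α) := by
  simp only [closedReturns, Set.ofPred_exists]
  exact .iUnion fun n => (T.measurableSet_consecutiveVisits α 0 n).inter
    (measurableSet_eq_fun (T.measurable_billiardMap.iterate n).snd.fst measurable_snd.fst)

theorem ae_exists_consecutiveVisits (α : Fin q) :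
    ∀ᵐ z ∂T.liouville, z.1 = α → ∃ n, T.ConsecutiveVisits α z 0 n := by
  classical
  filter_upwards [T.measurePreserving_billiardMap.conservative.ae_mem_imp_frequently_image_mem
    (measurableSet_preimage_fst α).nullMeasurableSet] with z hz hzα
  have hreturn : ∃ n, 0 < n ∧ T.Visits α z n :=
    ((hz hzα).and_eventually (eventually_gt_atTop 0)).exists.imp fun _ h => h.symm
  exact ⟨Nat.find hreturn, (Nat.find_spec hreturn).1, hzα, (Nat.find_spec hreturn).2,
    fun j hj hjn hv => Nat.find_min hreturn hjn ⟨hj, hv⟩⟩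

theorem iUnion_openReturns_ae_eq (α : Fin q) :
    ⋃ n, T.openReturns α n =ᵐ[T.liouville] (Prod.fst ⁻¹' {α} \ T.closedReturns α :) := by
  filter_upwards [T.ae_exists_consecutiveVisits α] with z hz
  refine propext ⟨fun h => ?_, fun ⟨hα, hclosed⟩ => ?_⟩
  · obtain ⟨n, hn, hne⟩ := Set.mem_iUnion.1 h
    refine ⟨hn.2.1, fun ⟨m, hm, heq⟩ => hne ?_⟩
    rw [hn.unique hm, heq]
  · obtain ⟨n, hn⟩ := hz hα
    exact Set.mem_iUnion.2 ⟨n, hn, fun heq => hclosed ⟨n, hn, heq.symm⟩⟩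

theorem gain_eq_zero_of_notMem_iUnion_openReturns (h : z ∉ ⋃ n, T.openReturns α n) :
    T.gain α z = 0 := by
  obtain hr | hr := eq_or_ne (T.returnTime α z) 0
  · exact T.gain_eq_zero hr
  · have heq : z.2.1 = (T.billiardMap^[T.returnTime α z] z).2.1 := by_contra fun hne =>
      h (Set.mem_iUnion.2 ⟨_, T.consecutiveVisits_zero_iff.2 ⟨hr, rfl⟩, hne⟩)
    rw [gain, ← heq, increment_self]

theorem integral_gain (α : Fin q) : ∫ z, T.gain α z ∂T.liouville =
    T.L α ^ 2 - T.L α / 2 * T.liouville.real (T.closedReturns α) := by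
  have hdisj : Pairwise (Function.onFun Disjoint (T.openReturns α)) := fun m n hmn =>
    Set.disjoint_left.2 fun z hz hz' => hmn (hz.1.unique hz'.1)
  have hgain := hasSum_integral_iUnion (T.measurableSet_openReturns α) hdisj
    (T.integrable_gain α).integrableOn
  simp only [T.setIntegral_openReturns_gain α] at hgain
  have hmeasure : HasSum (fun n => T.L α / 2 * T.liouville.real (T.openReturns α n))
      (T.L α / 2 * T.liouville.real (⋃ n, T.openReturns α n)) := by
    simpa only [setIntegral_const, smul_eq_mul, mul_comm (T.L α / 2)] using
      hasSum_integral_iUnion (T.measurableSet_openReturns α) hdisj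
        (integrable_const (μ := T.liouville) (T.L α / 2)).integrableOn
  have hclosed : T.closedReturns α ⊆ Prod.fst ⁻¹' {α} := fun z ⟨_, hn, _⟩ => hn.2.1
  calc ∫ z, T.gain α z ∂T.liouville
      = ∫ z in ⋃ n, T.openReturns α n, T.gain α z ∂T.liouville :=
        (setIntegral_eq_integral_of_forall_compl_eq_zero fun z hz =>
          T.gain_eq_zero_of_notMem_iUnion_openReturns hz).symm
    _ = T.L α / 2 * T.liouville.real (⋃ n, T.openReturns α n) := hgain.unique hmeasure
    _ = T.L α / 2 * (2 * T.L α - T.liouville.real (T.closedReturns α)) := by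
        rw [measureReal_congr (T.iUnion_openReturns_ae_eq α),
          measureReal_sdiff hclosed (T.measurableSet_closedReturns α),
          T.liouville_real_preimage_fst]
    _ = T.L α ^ 2 - T.L α / 2 * T.liouville.real (T.closedReturns α) := by ring

theorem ae_hasFootpointGain (α : Fin q) : ∀ᵐ z ∂T.liouville,
    T.HasFootpointGain α z (birkhoffLimsup T.billiardMap (T.gain α) z) :=
  (ae_tendsto_birkhoffAverage T.measurePreserving_billiardMap (T.measurable_gain α)
    (T.abs_gain_le α)).mono fun _ hz => T.hasFootpointGain_of_tendsto_birkhoffAverage hz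

theorem footpointGain_ae_eq (α : Fin q) : (fun z => T.footpointGain z α) =ᵐ[T.liouville]
    birkhoffLimsup T.billiardMap (T.gain α) :=
  (T.ae_hasFootpointGain α).mono fun _ hz => hz.limUnder_eq

theorem integrable_footpointGain : Integrable T.footpointGain T.liouville :=
  .of_eval fun α => (integrable_birkhoffLimsup T.measurable_billiardMap (T.measurable_gain α)
    (T.abs_gain_le α)).congr (T.footpointGain_ae_eq α).symm

theorem integral_footpointGain (α : Fin q) : ∫ z, T.footpointGain z α ∂T.liouville =
    T.L α ^ 2 - T.L α / 2 * T.liouville.real (T.closedReturns α) := by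
  rw [integral_congr_ae (T.footpointGain_ae_eq α), integral_birkhoffLimsup
    T.measurePreserving_billiardMap (T.measurable_gain α) (T.abs_gain_le α), T.integral_gain]

theorem integral_rotationVector_apply (α : Fin q) : (∫ z, T.rotationVector z ∂T.liouville) α =
    (∫ z, T.footpointGain z α ∂T.liouville) / T.L α := by
  have hint (β : Fin q) : Integrable (fun z => T.rotationVector z β) T.liouville :=
    (T.integrable_footpointGain.eval β).div_const (T.L β)
  rw [eval_integral hint]
  exact integral_div _ _

theorem ae_rotationVector_eq_of_isErgodic (h : T.IsErgodic) : ∀ᵐ z ∂T.liouville,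
    T.rotationVector z =
      (T.liouville.real Set.univ)⁻¹ • ∫ w, T.rotationVector w ∂T.liouville := by
  obtain hzero | hne := eq_zero_or_neZero T.liouville
  · simp [hzero]
  have hgain (α : Fin q) := (T.footpointGain_ae_eq α).trans (birkhoffLimsup_ae_eq_average
    T.measurePreserving_billiardMap h (T.measurable_gain α) (T.abs_gain_le α))
  filter_upwards [ae_all_iff.2 hgain] with z hz
  ext α
  rw [rotationVector, hz, average_eq, Pi.smul_apply, integral_rotationVector_apply,
    integral_footpointGain, integral_gain, smul_eq_mul, smul_eq_mul, mul_div_assoc]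

end MeanGain

end BilliardTable

end

theorem mainTheorem2 {q : ℕ} (T : BilliardTable q) :
    (∀ᵐ z ∂T.liouville, ∀ α, ∃ u, T.HasFootpointGain α z u) ∧
    Integrable T.footpointGain T.liouville ∧
    (∀ α, ∫ z, T.footpointGain z α ∂T.liouville =
      T.L α ^ 2 - T.L α / 2 * T.liouville.real (T.closedReturns α)) ∧
    ((∀ α, T.liouville (T.closedReturns α) = 0) →
      (∀ α, ∫ z, T.footpointGain z α ∂T.liouville = T.L α ^ 2) ∧
      (T.liouville.real Set.univ)⁻¹ • ∫ z, T.rotationVector z ∂T.liouville =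
        (fun α => 1 / 2 * (T.L α / T.perimeter)) ∧
      (T.IsErgodic → ∀ᵐ z ∂T.liouville,
        T.rotationVector z = fun α => 1 / 2 * (T.L α / T.perimeter))) := by
  refine ⟨ae_all_iff.2 fun α => (T.ae_hasFootpointGain α).mono fun _ hz => ⟨_, hz⟩,
    T.integrable_footpointGain, T.integral_footpointGain, fun hclosed => ?_⟩
  have hgain (α : Fin q) : ∫ z, T.footpointGain z α ∂T.liouville = T.L α ^ 2 := by
    rw [T.integral_footpointGain, Measure.real, hclosed, ENNReal.toReal_zero, mul_zero, sub_zero]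
  have hmean : (T.liouville.real Set.univ)⁻¹ • ∫ z, T.rotationVector z ∂T.liouville =
      fun α => 1 / 2 * (T.L α / T.perimeter) := by
    ext α
    have hL := T.L_pos α
    have hperimeter := T.perimeter_pos α
    rw [Pi.smul_apply, T.integral_rotationVector_apply, hgain, T.liouville_real_univ, smul_eq_mul]
    field_simp
  exact ⟨hgain, hmean, fun hergodic =>
    (T.ae_rotationVector_eq_of_isErgodic hergodic).mono fun _ hz => hz.trans hmean⟩
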